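/- A matching of a graph is a set of pairwise non-adjacent edges, and a maximum matching is a matching whose number of edges is the largest among all matchings of the graph. For $n\ge 1$ let $N_m(n)$ be the total number of maximum matchings among the $n^{n-2}$ labeled trees on $n$ vertices, that is, the sum, over all trees with vertex set $\{1,\dots,n\}$, of the number of maximum matchings of the tree. Then the exponential generating function $F_m(x)=\sum_{n\ge 1}\frac{N_m(n)}{n!}x^n$ is, as a formal power series, $$F_m(x)=-\tfrac12\,(xe^U+U)^2+(1+Uxe^U)\,xe^U+U-U^2,$$ where $U=U(x)$ is the unique formal power series with rational coefficients and zero constant term that satisfies $$U=x^2e^{-x^2e^{2U}+xe^U+3U}.$$ Moreover, $(N_m(1),N_m(2),\dots,N_m(10))=(1,1,6,24,320,3270,55482,999656,21718440,544829130)$. -/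

import Mathlib

namespace TreeMatchings

/-- A subgraph `M` of `G` is a maximum matching of `G`: it is a matching (a set of pairwise
non-adjacent edges, together with their end-vertices), and its number of edges is the largest
among all matchings of `G`. -/
def IsMaximumMatching {V : Type*} {G : SimpleGraph V} (M : G.Subgraph) : Prop :=
  M.IsMatching ∧ ∀ M' : G.Subgraph, M'.IsMatching → M'.edgeSet.ncard ≤ M.edgeSet.ncard

/-- The number of maximum matchings of the graph `G` (used for finite graphs). -/
noncomputable def numMaximumMatchings {V : Type*} (G : SimpleGraph V) : ℕ :=
  {M : G.Subgraph | IsMaximumMatching M}.ncard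

open Classical in
/-- The total number of maximum matchings, summed over all labeled trees on `n` vertices.
For `n = 0` the sum is empty, since a tree has at least one vertex. -/
noncomputable def totalMaximumMatchings (n : ℕ) : ℕ :=
  ∑ G : SimpleGraph (Fin n) with G.IsTree, numMaximumMatchings G

/-- The exponential generating function of the total number of maximum matchings. -/
noncomputable def matchingEGF : PowerSeries ℚ :=
  PowerSeries.mk fun n => (totalMaximumMatchings n : ℚ) / (n.factorial : ℚ)

/-- The exponential `e ^ f` of a formal power series `f` with zero constant coefficient. -/
noncomputable def expSeries (f : PowerSeries ℚ) : PowerSeries ℚ :=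
  (PowerSeries.exp ℚ).subst f

/-- The functional equation `U = x ^ 2 * e ^ (-x ^ 2 * e ^ (2 * U) + x * e ^ U + 3 * U)`, for a
formal power series `U` in `x` with zero constant coefficient (so that every exponential is that
of a series with zero constant coefficient). -/
def IsSolution (U : PowerSeries ℚ) : Prop :=
  PowerSeries.constantCoeff U = 0 ∧
    U = PowerSeries.X ^ 2 *
      expSeries (-(PowerSeries.X ^ 2 * expSeries (2 * U)) + PowerSeries.X * expSeries U + 3 * U)

end TreeMatchings

/-! To a tree rooted at r attach the polynomials f and g that count, by size, all matchings and the
matchings avoiding r. The leading coefficient of f is the number of maximum matchings, and deg f -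
deg g is 0 or 1, being 1 exactly when every maximum matching covers r. Let A and B be the
exponential generating functions of the leading coefficient of f over the rooted trees with
difference 1 and 0 respectively, and D and C those of the leading coefficient of g over the same two
classes.

Joining two rooted trees by an edge between their roots, and keeping the second root, produces the
pair (f₁f₂ + X g₁g₂, f₁g₂). Comparing degrees turns this into bilinear rules for the four weights
(`weights_join`). Cutting at an oriented edge inverts joining (`sum_oriented_edges`). The branches
at a root have n - 1 vertices in all, so weighting each cut by the size of its branch gives a
differential system in x d/dx (`rootedSystem_egf`). It integrates to B = C + CD, A = C(C + D), C = x
e^A and C + D = x e^(A+B). Eliminating B, C and D shows that U = A solves the functional equation,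
and an X-adic argument gives uniqueness.

A tree has one more vertex than it has edges, so F is the vertex-rooted series A + B minus the
edge-rooted series, which is half the sum over oriented cuts (`unrooted`). The ten values come from
solving the integrated relations degree by degree. -/

namespace TreeMatchings

/-! ### Power series: the Euler operator and exponentials -/

open PowerSeries

/-- The Euler operator `x d/dx` on formal power series. -/
noncomputable def euler (f : ℚ⟦X⟧) : ℚ⟦X⟧ := X * derivative ℚ f

theorem coeff_euler (f : ℚ⟦X⟧) (n : ℕ) : coeff n (euler f) = n * coeff n f := by
  cases n with
  | zero => simp [euler]
  | succ n =>
    rw [euler, coeff_succ_X_mul, coeff_derivative]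
    push_cast
    ring

theorem euler_add (f g : ℚ⟦X⟧) : euler (f + g) = euler f + euler g := by
  simp [euler, mul_add]

theorem euler_sub (f g : ℚ⟦X⟧) : euler (f - g) = euler f - euler g := by
  simp [euler, mul_sub]

theorem euler_mul (f g : ℚ⟦X⟧) : euler (f * g) = euler f * g + f * euler g := by
  simp only [euler, Derivation.leibniz, smul_eq_mul]
  ring

theorem euler_X : euler X = X := by
  simp [euler]

theorem hasSubst_of_constantCoeff {f : ℚ⟦X⟧} (hf : constantCoeff f = 0) : HasSubst f :=
  HasSubst.of_constantCoeff_zero' hf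

theorem euler_expSeries {f : ℚ⟦X⟧} (hf : constantCoeff f = 0) :
    euler (expSeries f) = expSeries f * euler f := by
  rw [euler, expSeries, derivative_subst (hasSubst_of_constantCoeff hf), derivative_exp, euler]
  ring

theorem constantCoeff_expSeries {f : ℚ⟦X⟧} (hf : constantCoeff f = 0) :
    constantCoeff (expSeries f) = 1 := by
  have h := constantCoeff_subst_eq_zero (a := f) hf (exp ℚ - 1) (by simp)
  have h' : (exp ℚ).subst f = (exp ℚ - 1).subst f + 1 := by
    rw [subst_sub (hasSubst_of_constantCoeff hf)]
    have : (1 : ℚ⟦X⟧).subst f = (1 : ℚ⟦X⟧) := by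
      rw [← coe_substAlgHom (hasSubst_of_constantCoeff hf), map_one]
    rw [this]; ring
  rw [expSeries, h', map_add, map_one]
  exact (congrArg (· + 1) h).trans (zero_add 1)

/-- In degree n the equation expresses (n - 1) times the coefficient of W through lower
coefficients, because Q has no constant term. Only degree 1 is left free, hence the hypothesis `h1`.
-/
theorem eq_zero_of_euler_eq {W Q : ℚ⟦X⟧} (hW : euler W = W * (1 + Q))
    (hQ : constantCoeff Q = 0) (h1 : coeff 1 W = 0) : W = 0 := by
  ext n
  induction n using Nat.strong_induction_on with
  | _ n ih =>
    have h := congrArg (coeff n) hW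
    have hs : coeff n (W * Q) = 0 := by
      rw [coeff_mul]
      refine Finset.sum_eq_zero fun p hp => ?_
      rw [Finset.HasAntidiagonal.mem_antidiagonal] at hp
      rcases Nat.eq_zero_or_pos p.2 with h0 | h0
      · rw [h0, coeff_zero_eq_constantCoeff_apply, hQ, mul_zero]
      · rw [ih p.1 (by omega)]; simp
    rw [coeff_euler, mul_add, mul_one, map_add, hs, add_zero] at h
    by_cases hn : n = 1
    · subst hn; simpa using h1
    · have : ((n : ℚ) - 1) ≠ 0 := by
        rw [sub_ne_zero]; exact_mod_cast hn
      have h2 : ((n : ℚ) - 1) * coeff n W = 0 := by linarith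
      simpa [this] using h2

theorem eq_of_euler_eq {Y Z Q : ℚ⟦X⟧} (hY : euler Y = Y * (1 + Q)) (hZ : euler Z = Z * (1 + Q))
    (hQ : constantCoeff Q = 0) (h1 : coeff 1 Y = coeff 1 Z) : Y = Z := by
  refine sub_eq_zero.1 (eq_zero_of_euler_eq (Q := Q) ?_ hQ (by rw [map_sub, h1, sub_self]))
  rw [euler_sub, hY, hZ]; ring

theorem constantCoeff_euler (f : ℚ⟦X⟧) : constantCoeff (euler f) = 0 := by
  simp [euler]

theorem euler_X_mul_expSeries {f : ℚ⟦X⟧} (hf : constantCoeff f = 0) :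
    euler (X * expSeries f) = X * expSeries f * (1 + euler f) := by
  rw [euler_mul, euler_X, euler_expSeries hf]; ring

theorem coeff_one_X_mul_expSeries {f : ℚ⟦X⟧} (hf : constantCoeff f = 0) :
    coeff 1 (X * expSeries f) = 1 := by
  rw [show (1 : ℕ) = 0 + 1 from rfl, coeff_succ_X_mul, coeff_zero_eq_constantCoeff_apply,
    constantCoeff_expSeries hf]

/-- Integrates a logarithmic derivative; this is how exponentials emerge from the differential
system. -/
theorem eq_X_mul_expSeries {Y f : ℚ⟦X⟧} (hf : constantCoeff f = 0)
    (hY : euler Y = Y * (1 + euler f)) (h1 : coeff 1 Y = 1) : Y = X * expSeries f :=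
  eq_of_euler_eq hY (euler_X_mul_expSeries hf) (constantCoeff_euler f)
    (h1.trans (coeff_one_X_mul_expSeries hf).symm)

/-- After multiplication by `X` both sides solve the same first-order Euler equation with the same
coefficient in degree 1. -/
theorem expSeries_add {f g : ℚ⟦X⟧} (hf : constantCoeff f = 0) (hg : constantCoeff g = 0) :
    expSeries (f + g) = expSeries f * expSeries g := by
  have hfg : constantCoeff (f + g) = 0 := by rw [map_add, hf, hg, add_zero]
  have h : X * expSeries f * expSeries g = X * expSeries (f + g) := by
    refine eq_X_mul_expSeries hfg ?_ ?_
    · rw [euler_mul, euler_X_mul_expSeries hf, euler_expSeries hg, euler_add]; ring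
    · rw [mul_assoc, show (1 : ℕ) = 0 + 1 from rfl, coeff_succ_X_mul,
        coeff_zero_eq_constantCoeff_apply, map_mul, constantCoeff_expSeries hf,
        constantCoeff_expSeries hg, one_mul]
  rw [mul_assoc] at h
  exact (mul_left_cancel₀ X_ne_zero h).symm

theorem X_pow_dvd_expSeries_sub_one {h : ℚ⟦X⟧} (h0 : constantCoeff h = 0) {n : ℕ}
    (hn : X ^ n ∣ h) : X ^ n ∣ expSeries h - 1 := by
  rw [X_pow_dvd_iff] at hn ⊢
  intro m hm
  rcases Nat.eq_zero_or_pos m with rfl | hpos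
  · rw [coeff_zero_eq_constantCoeff_apply, map_sub, constantCoeff_expSeries h0, map_one, sub_self]
  · have e := congrArg (coeff m) (euler_expSeries h0)
    rw [coeff_euler, coeff_mul, Finset.sum_eq_zero] at e
    · have hm' : (m : ℚ) ≠ 0 := by exact_mod_cast hpos.ne'
      have : coeff m (expSeries h) = 0 := by simpa [hm'] using e
      rw [map_sub, this, coeff_one, if_neg hpos.ne', sub_zero]
    · intro p hp
      rw [Finset.HasAntidiagonal.mem_antidiagonal] at hp
      rw [coeff_euler, hn p.2 (by omega), mul_zero, mul_zero]

theorem X_pow_dvd_expSeries_sub {f g : ℚ⟦X⟧} (hf : constantCoeff f = 0)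
    (hg : constantCoeff g = 0) {n : ℕ} (hn : X ^ n ∣ f - g) :
    X ^ n ∣ expSeries f - expSeries g := by
  have hfg : constantCoeff (f - g) = 0 := by rw [map_sub, hf, hg, sub_zero]
  have h : expSeries f - expSeries g = expSeries g * (expSeries (f - g) - 1) := by
    rw [mul_sub, ← expSeries_add hg hfg, add_sub_cancel, mul_one]
  rw [h]
  exact (X_pow_dvd_expSeries_sub_one hfg hn).mul_left _

/-! ### Uniqueness for the functional equation -/

theorem constantCoeff_exponent {U : ℚ⟦X⟧} (hU : constantCoeff U = 0) :
    constantCoeff (-(X ^ 2 * expSeries (2 * U)) + X * expSeries U + 3 * U) = 0 := by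
  simp [hU]

/-- The right-hand side is an X-adic contraction: exponentials preserve the order of agreement of
two solutions and the factor `X ^ 2` raises it. -/
theorem IsSolution.unique {U V : ℚ⟦X⟧} (hU : IsSolution U) (hV : IsSolution V) : U = V := by
  have key : ∀ n : ℕ, X ^ (n + 1) ∣ U - V := by
    intro n
    induction n with
    | zero =>
      rw [zero_add, pow_one, X_dvd_iff, map_sub, hU.1, hV.1, sub_zero]
    | succ n ih =>
      have h2 : X ^ (n + 1) ∣ 2 * U - 2 * V := by
        rw [← mul_sub]; exact ih.mul_left _
      have d2 := X_pow_dvd_expSeries_sub (by simp [hU.1]) (by simp [hV.1]) h2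
      have d1 := X_pow_dvd_expSeries_sub hU.1 hV.1 ih
      have d := X_pow_dvd_expSeries_sub (constantCoeff_exponent hU.1)
        (constantCoeff_exponent hV.1) (n := n + 1) (by
          have : (-(X ^ 2 * expSeries (2 * U)) + X * expSeries U + 3 * U)
              - (-(X ^ 2 * expSeries (2 * V)) + X * expSeries V + 3 * V)
              = -X ^ 2 * (expSeries (2 * U) - expSeries (2 * V))
                + X * (expSeries U - expSeries V) + 3 * (U - V) := by ring
          rw [this]
          exact dvd_add (dvd_add (d2.mul_left _) (d1.mul_left _)) (ih.mul_left _))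
      rw [hU.2, hV.2, ← mul_sub]
      refine (dvd_trans ?_ (mul_dvd_mul_left (X ^ 2) d))
      rw [← pow_add]
      exact pow_dvd_pow _ (by omega)
  ext n
  have := X_pow_dvd_iff.1 (key n) n (by omega)
  rwa [map_sub, sub_eq_zero] at this

/-! ### The differential system for rooted trees and its solution -/

/-- The differential system satisfied by the generating functions `A`, `B`, `C`, `D` of rooted
trees, together with the initial conditions. -/
structure RootedSystem (A B C D : ℚ⟦X⟧) : Prop where
  eulerA : euler A - A = euler A * A + euler B * A + euler C * D + euler C * C
  eulerB : euler B - B = euler A * B + euler D * C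
  eulerC : euler C - C = euler A * C
  eulerD : euler D - D = euler A * D + euler B * D + euler B * C
  zeroA : constantCoeff A = 0
  zeroB : constantCoeff B = 0
  zeroC : constantCoeff C = 0
  zeroD : constantCoeff D = 0
  oneA : coeff 1 A = 0
  oneB : coeff 1 B = 1
  oneC : coeff 1 C = 1
  oneD : coeff 1 D = 0

theorem coeff_one_mul_of_constantCoeff {f g : ℚ⟦X⟧} (hf : constantCoeff f = 0)
    (hg : constantCoeff g = 0) : coeff 1 (f * g) = 0 := by
  rw [coeff_mul, Finset.Nat.antidiagonal_succ]
  simp [hf, hg]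

namespace RootedSystem

variable {A B C D : ℚ⟦X⟧}

/-- The term `euler D * C` cancels in the difference W of the two sides, leaving `euler W = W * (1 +
euler A)`, which forces W = 0. -/
theorem eq_B (h : RootedSystem A B C D) : B = C + C * D := by
  have hW : B - (C + C * D) = 0 := by
    refine eq_zero_of_euler_eq (Q := euler A) ?_ (constantCoeff_euler A) ?_
    · rw [euler_sub, euler_add, euler_mul]
      linear_combination h.eulerB - (1 + D) * h.eulerC
    · rw [map_sub, map_add, h.oneB, h.oneC, coeff_one_mul_of_constantCoeff h.zeroC h.zeroD]
      norm_num
  exact sub_eq_zero.1 hW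

theorem eq_A (h : RootedSystem A B C D) : A = C * (D + C) := by
  have hW : A - C * (D + C) = 0 := by
    refine eq_zero_of_euler_eq (Q := euler A + euler B) ?_
      (by rw [map_add, constantCoeff_euler, constantCoeff_euler, add_zero]) ?_
    · rw [euler_sub, euler_mul, euler_add]
      linear_combination h.eulerA - C * h.eulerD - C * h.eulerC
    · rw [map_sub, h.oneA, coeff_one_mul_of_constantCoeff h.zeroC (by simp [h.zeroC, h.zeroD]),
        sub_zero]
  exact sub_eq_zero.1 hW

theorem eq_C (h : RootedSystem A B C D) : C = X * expSeries A :=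
  eq_X_mul_expSeries h.zeroA (by linear_combination h.eulerC) h.oneC

theorem eq_D_add_C (h : RootedSystem A B C D) : D + C = X * expSeries (A + B) := by
  refine eq_X_mul_expSeries (by simp [h.zeroA, h.zeroB]) ?_ (by simp [h.oneC, h.oneD])
  rw [euler_add, euler_add]
  linear_combination h.eulerD + h.eulerC

/-- Multiplying the two exponential formulas gives A = x² e^(2A+B), and B = C + A - C² turns 2A + B
into the required exponent. -/
theorem isSolution (h : RootedSystem A B C D) : IsSolution A := by
  refine ⟨h.zeroA, ?_⟩
  have hB : B = C + A - C ^ 2 := by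
    linear_combination h.eq_B - h.eq_A
  have hAA : constantCoeff (A + A) = 0 := by simp [h.zeroA]
  have h2 : expSeries (2 * A) = expSeries A * expSeries A := by
    rw [two_mul, expSeries_add h.zeroA h.zeroA]
  have hexp : -(X ^ 2 * expSeries (2 * A)) + X * expSeries A + 3 * A = A + (A + B) := by
    rw [h2, hB, h.eq_C]; ring
  rw [hexp, expSeries_add h.zeroA (by simp [h.zeroA, h.zeroB])]
  calc A = C * (D + C) := h.eq_A
    _ = X * expSeries A * (X * expSeries (A + B)) := by rw [h.eq_D_add_C, ← h.eq_C]
    _ = _ := by ring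

/-- The generating function of unrooted trees, from the vertex-rooted and edge-rooted ones. -/
theorem unrooted (h : RootedSystem A B C D) {F : ℚ⟦X⟧} (hv : euler F = A + B)
    (he : euler F - F
      = (1 / 2 : ℚ) • (A * A + A * B + D * C + B * A + C * D + C * C)) :
    F = -((1 / 2 : ℚ) • (X * expSeries A + A) ^ 2)
          + (1 + A * (X * expSeries A)) * (X * expSeries A) + A - A ^ 2 := by
  rw [← h.eq_C]
  have hB : B = C + A - C ^ 2 := by
    linear_combination h.eq_B - h.eq_A
  have hCD : C * D = A - C ^ 2 := by linear_combination -h.eq_A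
  have e : A * A + A * B + D * C + B * A + C * D + C * C
      = (C + A) ^ 2 + (2 : ℚ) • (A * B + A - C ^ 2 - A * C) := by
    rw [show (2 : ℚ) • (A * B + A - C ^ 2 - A * C) = 2 * (A * B + A - C ^ 2 - A * C) by
      rw [two_smul]; ring]
    linear_combination 2 * hCD
  rw [e, smul_add, smul_smul] at he
  norm_num at he
  -- F = euler F - (euler F - F): vertex-rooted trees minus edge-rooted trees.
  have hF : F = A + B - (1 / 2 : ℚ) • (C + A) ^ 2 - (A * B + A - C ^ 2 - A * C) := by
    norm_num
    linear_combination hv - he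
  rw [hF, hB]
  ring

/-- The coefficient of A + B in degree n is n N(n)/n!, hence the factor (n - 1)!. The sum D + C is
tracked instead of D because it satisfies a closed linear recurrence. -/
theorem coeff_values (h : RootedSystem A B C D) :
    List.map (fun n => coeff n (A + B) * ((n - 1).factorial : ℚ)) [1, 2, 3, 4, 5, 6, 7, 8, 9, 10]
      = [1, 1, 6, 24, 320, 3270, 55482, 999656, 21718440, 544829130] := by
  have hsum (f g : ℚ⟦X⟧) (n : ℕ) : coeff n (f * g)
      = ∑ i ∈ Finset.range (n + 1), coeff i f * coeff (n - i) g := by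
    rw [coeff_mul, Finset.Nat.sum_antidiagonal_eq_sum_range_succ_mk]
  have hA (n : ℕ) := (congrArg (coeff n) h.eq_A).trans (hsum _ _ n)
  have hB (n : ℕ) : coeff n B = coeff n C + coeff n A
      - ∑ i ∈ Finset.range (n + 1), coeff i C * coeff (n - i) C := by
    rw [← hsum, ← map_add, ← map_sub]
    exact congrArg _ (by linear_combination h.eq_B - h.eq_A)
  have hC (n : ℕ) : n * coeff n C = coeff n C
      + ∑ i ∈ Finset.range (n + 1), i * coeff i A * coeff (n - i) C := by
    simp_rw [← coeff_euler]
    rw [← hsum, ← map_add]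
    exact congrArg _ (by linear_combination h.eulerC)
  have hE (n : ℕ) : n * coeff n (D + C) = coeff n (D + C)
      + ∑ i ∈ Finset.range (n + 1), i * (coeff i A + coeff i B) * coeff (n - i) (D + C) := by
    simp_rw [← map_add, ← coeff_euler]
    rw [← hsum, ← map_add]
    refine congrArg _ ?_
    rw [euler_add, euler_add]
    linear_combination h.eulerD + h.eulerC
  have h0 : coeff 0 A = 0 ∧ coeff 0 B = 0 ∧ coeff 0 C = 0 ∧ coeff 0 (D + C) = 0 := by
    simp [h.zeroA, h.zeroB, h.zeroC, h.zeroD]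
  have h1 : coeff 1 A = 0 ∧ coeff 1 B = 1 ∧ coeff 1 C = 1 ∧ coeff 1 (D + C) = 1 := by
    simp [h.oneA, h.oneB, h.oneC, h.oneD]
  simp only [fun n : ℕ => map_add (coeff n) A B]
  generalize ha : (fun n => coeff n A) = a
  generalize hb : (fun n => coeff n B) = b
  generalize hc : (fun n => coeff n C) = c
  generalize he : (fun n => coeff n (D + C)) = e
  simp only [funext_iff] at ha hb hc he
  simp only [ha, hb, hc, he] at hA hB hC hE h0 h1 ⊢
  clear ha hb hc he hsum
  -- From degree 2 on the factor n - 1 is nonzero. As constant terms vanish, the four relations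
  -- become linear in the new coefficients once the lower values are substituted.
  have h2 : a 2 = 1 ∧ b 2 = 0 ∧ c 2 = 0 ∧ e 2 = 1 := by
    have ha := hA 2; have hb := hB 2; have hc := hC 2; have he := hE 2
    norm_num [Finset.sum_range_succ, h0, h1] at ha hb hc he
    refine ⟨?_, ?_, ?_, ?_⟩ <;> linarith
  have h3 : a 3 = 1 ∧ b 3 = 2 ∧ c 3 = 1 ∧ e 3 = 3 / 2 := by
    have ha := hA 3; have hb := hB 3; have hc := hC 3; have he := hE 3
    norm_num [Finset.sum_range_succ, h0, h1, h2] at ha hb hc he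
    refine ⟨?_, ?_, ?_, ?_⟩ <;> linarith
  have h4 : a 4 = 5 / 2 ∧ b 4 = 3 / 2 ∧ c 4 = 1 ∧ e 4 = 25 / 6 := by
    have ha := hA 4; have hb := hB 4; have hc := hC 4; have he := hE 4
    norm_num [Finset.sum_range_succ, h0, h1, h2, h3] at ha hb hc he
    refine ⟨?_, ?_, ?_, ?_⟩ <;> linarith
  have h5 : a 5 = 37 / 6 ∧ b 5 = 43 / 6 ∧ c 5 = 3 ∧ e 5 = 193 / 24 := by
    have ha := hA 5; have hb := hB 5; have hc := hC 5; have he := hE 5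
    norm_num [Finset.sum_range_succ, h0, h1, h2, h3, h4] at ha hb hc he
    refine ⟨?_, ?_, ?_, ?_⟩ <;> linarith
  have h6 : a 6 = 325 / 24 ∧ b 6 = 329 / 24 ∧ c 6 = 43 / 6 ∧ e 6 = 2701 / 120 := by
    have ha := hA 6; have hb := hB 6; have hc := hC 6; have he := hE 6
    norm_num [Finset.sum_range_succ, h0, h1, h2, h3, h4, h5] at ha hb hc he
    refine ⟨?_, ?_, ?_, ?_⟩ <;> linarith
  have h7 : a 7 = 4601 / 120 ∧ b 7 = 2323 / 60 ∧ c 7 = 401 / 24 ∧ e 7 = 39631 / 720 := by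
    have ha := hA 7; have hb := hB 7; have hc := hC 7; have he := hE 7
    norm_num [Finset.sum_range_succ, h0, h1, h2, h3, h4, h5, h6] at ha hb hc he
    refine ⟨?_, ?_, ?_, ?_⟩ <;> linarith
  have h8 : a 8 = 68851 / 720 ∧ b 8 = 73957 / 720 ∧ c 8 = 5701 / 120 ∧ e 8 = 750247 / 5040 := by
    have ha := hA 8; have hb := hB 8; have hc := hC 8; have he := hE 8
    norm_num [Finset.sum_range_succ, h0, h1, h2, h3, h4, h5, h6, h7] at ha hb hc he
    refine ⟨?_, ?_, ?_, ?_⟩ <;> linarith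
  have h9 : a 9 = 1345051 / 5040 ∧ b 9 = 684877 / 2520 ∧ c 9 = 86581 / 720 ∧ e 9 = 1088431 / 2688 := by
    have ha := hA 9; have hb := hB 9; have hc := hC 9; have he := hE 9
    norm_num [Finset.sum_range_succ, h0, h1, h2, h3, h4, h5, h6, h7, h8] at ha hb hc he
    refine ⟨?_, ?_, ?_, ?_⟩ <;> linarith
  have h10 : a 10 = 29404649 / 40320 ∧ b 10 = 10377307 / 13440 ∧ c 10 = 1714063 / 5040 ∧ e 10 = 57710911 / 51840 := by
    have ha := hA 10; have hb := hB 10; have hc := hC 10; have he := hE 10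
    norm_num [Finset.sum_range_succ, h0, h1, h2, h3, h4, h5, h6, h7, h8, h9] at ha hb hc he
    refine ⟨?_, ?_, ?_, ?_⟩ <;> linarith
  norm_num [Nat.factorial, h1, h2, h3, h4, h5, h6, h7, h8, h9, h10]

end RootedSystem
end TreeMatchings

namespace TreeMatchings

open Polynomial

/-! ### Matching polynomials with forbidden vertices -/

section MatchingPolynomial

variable {V W : Type*}

/-- `M` is a set of pairwise disjoint edges of `G`, none of which meets `R`. -/
structure IsEdgeMatching (G : SimpleGraph V) (R : Set V) (M : Finset (Sym2 V)) : Prop where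
  mem_edgeSet : ∀ e ∈ M, e ∈ G.edgeSet
  eq_of_mem : ∀ e ∈ M, ∀ f ∈ M, ∀ v, v ∈ e → v ∈ f → e = f
  avoid : ∀ e ∈ M, ∀ v ∈ e, v ∉ R

theorem IsEdgeMatching.subset {G : SimpleGraph V} {R : Set V} {M N : Finset (Sym2 V)}
    (h : IsEdgeMatching G R M) (hN : N ⊆ M) : IsEdgeMatching G R N :=
  ⟨fun e he => h.1 e (hN he), fun e he f hf => h.2 e (hN he) f (hN hf),
    fun e he => h.3 e (hN he)⟩

theorem edgeSet_map_mem {G : SimpleGraph V} (φ : V ↪ W) (e : Sym2 W) :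
    e ∈ (G.map φ).edgeSet ↔ ∃ f ∈ G.edgeSet, f.map φ = e := by
  rw [SimpleGraph.edgeSet_map]; rfl

theorem edgeSet_sup_edge_mem {G : SimpleGraph V} {s r : V} (hsr : s ≠ r) (e : Sym2 V) :
    e ∈ (G ⊔ SimpleGraph.edge s r).edgeSet ↔ e ∈ G.edgeSet ∨ e = s(s, r) := by
  rw [SimpleGraph.edgeSet_sup, SimpleGraph.edgeSet_edge, Set.mem_union, Set.mem_sdiff,
    Set.mem_singleton_iff]
  refine or_congr_right ⟨And.left, fun h => ⟨h, ?_⟩⟩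
  subst h
  simpa using hsr

open Classical in
/-- The matchings of `G` that avoid the vertices in `R`. -/
noncomputable def edgeMatchings [Fintype V] (G : SimpleGraph V) (R : Set V) :
    Finset (Finset (Sym2 V)) :=
  Finset.univ.filter (IsEdgeMatching G R)

/-- The generating polynomial, by size, of the matchings of `G` that avoid `R`. -/
noncomputable def matchingPoly [Fintype V] (G : SimpleGraph V) (R : Set V) : ℕ[X] :=
  ∑ M ∈ edgeMatchings G R, X ^ M.card

variable [Fintype V] [Fintype W]

theorem mem_edgeMatchings {G : SimpleGraph V} {R : Set V} {M : Finset (Sym2 V)} :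
    M ∈ edgeMatchings G R ↔ IsEdgeMatching G R M := by
  classical
  simp [edgeMatchings]

theorem coeff_matchingPoly (G : SimpleGraph V) (R : Set V) (k : ℕ) :
    (matchingPoly G R).coeff k = ((edgeMatchings G R).filter fun M => M.card = k).card := by
  simp only [matchingPoly, finsetSum_coeff, coeff_X_pow, Finset.card_filter, eq_comm]

theorem empty_mem_edgeMatchings (G : SimpleGraph V) (R : Set V) : ∅ ∈ edgeMatchings G R :=
  mem_edgeMatchings.2 ⟨by simp, by simp, by simp⟩

theorem matchingPoly_ne_zero (G : SimpleGraph V) (R : Set V) : matchingPoly G R ≠ 0 := by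
  intro h
  have h0 := coeff_matchingPoly G R 0
  rw [h, coeff_zero, eq_comm, Finset.card_eq_zero, Finset.filter_eq_empty_iff] at h0
  exact h0 (empty_mem_edgeMatchings G R) Finset.card_empty

theorem card_le_natDegree {G : SimpleGraph V} {R : Set V} {M : Finset (Sym2 V)}
    (hM : IsEdgeMatching G R M) : M.card ≤ (matchingPoly G R).natDegree := by
  refine le_natDegree_of_ne_zero ?_
  rw [coeff_matchingPoly, Finset.card_ne_zero]
  exact ⟨M, by simp [mem_edgeMatchings, hM]⟩

theorem exists_card_eq_natDegree (G : SimpleGraph V) (R : Set V) :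
    ∃ M, IsEdgeMatching G R M ∧ M.card = (matchingPoly G R).natDegree := by
  have h : (matchingPoly G R).coeff (matchingPoly G R).natDegree ≠ 0 :=
    leadingCoeff_ne_zero.2 (matchingPoly_ne_zero G R)
  rw [coeff_matchingPoly, Finset.card_ne_zero] at h
  obtain ⟨M, hM⟩ := h
  rw [Finset.mem_filter, mem_edgeMatchings] at hM
  exact ⟨M, hM⟩

theorem natDegree_matchingPoly_singleton_le (G : SimpleGraph V) (r : V) :
    (matchingPoly G {r}).natDegree ≤ (matchingPoly G ∅).natDegree := by
  obtain ⟨M, hM, hc⟩ := exists_card_eq_natDegree G {r}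
  rw [← hc]
  exact card_le_natDegree ⟨hM.1, hM.2, by simp⟩

/-- At most one edge of a maximum matching contains `r`; discarding it leaves a matching that avoids
`r`. -/
theorem natDegree_matchingPoly_le_succ (G : SimpleGraph V) (r : V) :
    (matchingPoly G ∅).natDegree ≤ (matchingPoly G {r}).natDegree + 1 := by
  classical
  obtain ⟨M, hM, hc⟩ := exists_card_eq_natDegree G ∅
  have h1 : (M.filter fun e => r ∈ e).card ≤ 1 := by
    rw [Finset.card_le_one]
    intro e he f hf
    rw [Finset.mem_filter] at he hf
    exact hM.2 e he.1 f hf.1 r he.2 hf.2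
  have h2 : (M.filter fun e => ¬ r ∈ e).card ≤ (matchingPoly G {r}).natDegree := by
    refine card_le_natDegree ⟨fun e he => hM.1 e (Finset.mem_filter.1 he).1,
      fun e he f hf => hM.2 e (Finset.mem_filter.1 he).1 f (Finset.mem_filter.1 hf).1, ?_⟩
    intro e he v hv hvr
    rw [Set.mem_singleton_iff] at hvr
    exact (Finset.mem_filter.1 he).2 (hvr ▸ hv)
  have := Finset.card_filter_add_card_filter_not (s := M) (fun e => r ∈ e)
  omega

/-- Matching polynomials do not see isolated vertices. -/
theorem matchingPoly_congr {G : SimpleGraph V} {R R' : Set V}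
    (h : ∀ a b, G.Adj a b → (a ∈ R ↔ a ∈ R')) : matchingPoly G R = matchingPoly G R' := by
  have : edgeMatchings G R = edgeMatchings G R' := by
    ext M
    rw [mem_edgeMatchings, mem_edgeMatchings]
    have key : ∀ e ∈ G.edgeSet, ∀ v ∈ e, (v ∈ R ↔ v ∈ R') := by
      intro e he v hv
      obtain ⟨w, rfl⟩ := Sym2.mem_iff_exists.1 hv
      exact h v w he
    constructor
    · exact fun hM => ⟨hM.1, hM.2, fun e he v hv => (key e (hM.1 e he) v hv).not.1 (hM.3 e he v hv)⟩
    · exact fun hM => ⟨hM.1, hM.2, fun e he v hv => (key e (hM.1 e he) v hv).not.2 (hM.3 e he v hv)⟩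
  rw [matchingPoly, this, matchingPoly]

theorem matchingPoly_map (G : SimpleGraph V) (φ : V ↪ W) (R : Set W) :
    matchingPoly (G.map φ) R = matchingPoly G (φ ⁻¹' R) := by
  classical
  symm
  refine Finset.sum_bij (fun M _ => M.map φ.sym2Map) ?_ ?_ ?_ ?_
  · intro M hM
    rw [mem_edgeMatchings] at hM ⊢
    refine ⟨?_, ?_, ?_⟩
    · intro e he
      obtain ⟨f, hf, rfl⟩ := Finset.mem_map.1 he
      exact (edgeSet_map_mem φ _).2 ⟨f, hM.1 f hf, rfl⟩
    · intro e he e' he' v hv hv'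
      obtain ⟨f, hf, rfl⟩ := Finset.mem_map.1 he
      obtain ⟨f', hf', rfl⟩ := Finset.mem_map.1 he'
      obtain ⟨x, hx, rfl⟩ := Sym2.mem_map.1 hv
      obtain ⟨y, hy, hxy⟩ := Sym2.mem_map.1 hv'
      rw [hM.2 f hf f' hf' x hx (φ.injective hxy ▸ hy)]
    · intro e he v hv
      obtain ⟨f, hf, rfl⟩ := Finset.mem_map.1 he
      obtain ⟨x, hx, rfl⟩ := Sym2.mem_map.1 hv
      exact hM.3 f hf x hx
  · intro M _ N _ h
    exact Finset.map_injective _ h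
  · intro N hN
    rw [mem_edgeMatchings] at hN
    refine ⟨Finset.univ.filter fun f => f.map φ ∈ N, ?_, ?_⟩
    · rw [mem_edgeMatchings]
      refine ⟨?_, ?_, ?_⟩
      · intro f hf
        obtain ⟨g, hg, hgf⟩ := (edgeSet_map_mem φ _).1 (hN.1 _ (Finset.mem_filter.1 hf).2)
        rwa [← Sym2.map.injective φ.injective hgf]
      · intro f hf f' hf' v hv hv'
        exact Sym2.map.injective φ.injective (hN.2 _ (Finset.mem_filter.1 hf).2 _
          (Finset.mem_filter.1 hf').2 (φ v) (Sym2.mem_map.2 ⟨v, hv, rfl⟩)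
          (Sym2.mem_map.2 ⟨v, hv', rfl⟩))
      · intro f hf v hv
        exact hN.3 _ (Finset.mem_filter.1 hf).2 _ (Sym2.mem_map.2 ⟨v, hv, rfl⟩)
    · ext e
      rw [Finset.mem_map]
      constructor
      · rintro ⟨f, hf, rfl⟩
        exact (Finset.mem_filter.1 hf).2
      · intro he
        obtain ⟨g, hg, hge⟩ := (edgeSet_map_mem φ _).1 (hN.1 _ he)
        exact ⟨g, Finset.mem_filter.2 ⟨Finset.mem_univ _, hge.symm ▸ he⟩, hge⟩
  · intro M _
    rw [Finset.card_map]

/-- The matching polynomial is multiplicative on vertex-disjoint unions. -/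
theorem matchingPoly_sup {G₁ G₂ : SimpleGraph V} {S : Set V}
    (h₁ : ∀ a b, G₁.Adj a b → a ∈ S) (h₂ : ∀ a b, G₂.Adj a b → a ∉ S) (R : Set V) :
    matchingPoly (G₁ ⊔ G₂) R = matchingPoly G₁ R * matchingPoly G₂ R := by
  classical
  have m₁ : ∀ e ∈ G₁.edgeSet, ∀ v ∈ e, v ∈ S := by
    intro e he v hv
    obtain ⟨w, rfl⟩ := Sym2.mem_iff_exists.1 hv
    exact h₁ v w he
  have m₂ : ∀ e ∈ G₂.edgeSet, ∀ v ∈ e, v ∉ S := by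
    intro e he v hv
    obtain ⟨w, rfl⟩ := Sym2.mem_iff_exists.1 hv
    exact h₂ v w he
  have hdisj : ∀ e ∈ G₁.edgeSet, e ∉ G₂.edgeSet := by
    intro e he he'
    induction e with
    | _ a b => exact h₂ a b he' (h₁ a b he)
  have hcard : ∀ M₁ ∈ edgeMatchings G₁ R, ∀ M₂ ∈ edgeMatchings G₂ R, Disjoint M₁ M₂ := by
    intro M₁ hM₁ M₂ hM₂
    rw [mem_edgeMatchings] at hM₁ hM₂
    exact Finset.disjoint_left.2 fun e he he' => hdisj e (hM₁.1 e he) (hM₂.1 e he')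
  rw [matchingPoly, matchingPoly, matchingPoly, Finset.sum_mul_sum, ← Finset.sum_product']
  symm
  refine Finset.sum_bij' (fun p _ => p.1 ∪ p.2)
    (fun M _ => (M.filter (· ∈ G₁.edgeSet), M.filter (· ∈ G₂.edgeSet))) ?_ ?_ ?_ ?_ ?_
  · rintro ⟨M₁, M₂⟩ hp
    rw [Finset.mem_product, mem_edgeMatchings, mem_edgeMatchings] at hp
    obtain ⟨hM₁, hM₂⟩ := hp
    rw [mem_edgeMatchings]
    refine ⟨?_, ?_, ?_⟩
    · intro e he
      rw [SimpleGraph.edgeSet_sup]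
      exact (Finset.mem_union.1 he).imp (hM₁.1 e) (hM₂.1 e)
    · intro e he f hf v hv hv'
      rcases Finset.mem_union.1 he with he | he <;> rcases Finset.mem_union.1 hf with hf | hf
      · exact hM₁.2 e he f hf v hv hv'
      · exact absurd (m₁ e (hM₁.1 e he) v hv) (m₂ f (hM₂.1 f hf) v hv')
      · exact absurd (m₁ f (hM₁.1 f hf) v hv') (m₂ e (hM₂.1 e he) v hv)
      · exact hM₂.2 e he f hf v hv hv'
    · intro e he
      exact (Finset.mem_union.1 he).elim (hM₁.3 e) (hM₂.3 e)
  · intro M hM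
    rw [mem_edgeMatchings] at hM
    rw [Finset.mem_product, mem_edgeMatchings, mem_edgeMatchings]
    refine ⟨⟨fun e he => (Finset.mem_filter.1 he).2, ?_, ?_⟩,
      ⟨fun e he => (Finset.mem_filter.1 he).2, ?_, ?_⟩⟩
    · exact (hM.subset (Finset.filter_subset _ _)).2
    · exact (hM.subset (Finset.filter_subset _ _)).3
    · exact (hM.subset (Finset.filter_subset _ _)).2
    · exact (hM.subset (Finset.filter_subset _ _)).3
  · rintro ⟨M₁, M₂⟩ hp
    rw [Finset.mem_product, mem_edgeMatchings, mem_edgeMatchings] at hp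
    obtain ⟨hM₁, hM₂⟩ := hp
    ext e
    · have a := hM₁.1 e
      have b := hM₂.1 e
      have c := hdisj e
      simp only [Finset.mem_filter, Finset.mem_union]
      tauto
    · have a := hM₁.1 e
      have b := hM₂.1 e
      have c := hdisj e
      simp only [Finset.mem_filter, Finset.mem_union]
      tauto
  · intro M hM
    rw [mem_edgeMatchings] at hM
    ext e
    have a := hM.1 e
    rw [SimpleGraph.edgeSet_sup, Set.mem_union] at a
    simp only [Finset.mem_filter, Finset.mem_union]
    tauto
  · rintro ⟨M₁, M₂⟩ hp
    rw [Finset.mem_product] at hp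
    rw [Finset.card_union_of_disjoint (hcard M₁ hp.1 M₂ hp.2), pow_add]

/-- Adding an edge that meets the forbidden set does not change the matching polynomial. -/
theorem matchingPoly_sup_edge_of_mem {G : SimpleGraph V} {s r : V} (hsr : s ≠ r) {R : Set V}
    (hr : r ∈ R) : matchingPoly (G ⊔ SimpleGraph.edge s r) R = matchingPoly G R := by
  have : edgeMatchings (G ⊔ SimpleGraph.edge s r) R = edgeMatchings G R := by
    ext M
    rw [mem_edgeMatchings, mem_edgeMatchings]
    constructor
    · refine fun hM => ⟨fun e he => ?_, hM.2, hM.3⟩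
      rcases (edgeSet_sup_edge_mem hsr e).1 (hM.1 e he) with h | rfl
      · exact h
      · exact absurd hr (hM.3 _ he r (Sym2.mem_mk_right s r))
    · exact fun hM => ⟨fun e he => (edgeSet_sup_edge_mem hsr e).2 (Or.inl (hM.1 e he)),
        hM.2, hM.3⟩
  rw [matchingPoly, this, matchingPoly]

/-- The deletion recurrence of the matching polynomial. -/
theorem matchingPoly_sup_edge {G : SimpleGraph V} {s r : V} (hsr : s ≠ r) (hG : ¬ G.Adj s r) :
    matchingPoly (G ⊔ SimpleGraph.edge s r) ∅ =
      matchingPoly G ∅ + X * matchingPoly G {s, r} := by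
  classical
  rw [matchingPoly, ← Finset.sum_filter_add_sum_filter_not _ (fun M => s(s, r) ∉ M)]
  congr 1
  · rw [matchingPoly]
    refine Finset.sum_congr ?_ fun _ _ => rfl
    ext M
    rw [Finset.mem_filter, mem_edgeMatchings, mem_edgeMatchings]
    constructor
    · rintro ⟨hM, hn⟩
      refine ⟨fun e he => ?_, hM.2, hM.3⟩
      rcases (edgeSet_sup_edge_mem hsr e).1 (hM.1 e he) with h | rfl
      · exact h
      · exact absurd he hn
    · exact fun hM => ⟨⟨fun e he => (edgeSet_sup_edge_mem hsr e).2 (Or.inl (hM.1 e he)),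
        hM.2, hM.3⟩, fun h => hG (hM.1 _ h)⟩
  -- A matching using the new edge is that edge together with a matching avoiding both of its ends.
  · rw [matchingPoly, Finset.mul_sum]
    symm
    refine Finset.sum_bij' (fun M _ => insert s(s, r) M) (fun M _ => M.erase s(s, r))
      ?_ ?_ ?_ ?_ ?_
    · intro M hM
      rw [mem_edgeMatchings] at hM
      rw [Finset.mem_filter, mem_edgeMatchings]
      have hav : ∀ e ∈ M, ∀ v ∈ e, v ∉ s(s, r) := by
        intro e he v hv hv'
        exact hM.3 e he v hv (by simpa using hv')
      refine ⟨⟨?_, ?_, by simp⟩, by simp⟩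
      · intro e he
        rw [edgeSet_sup_edge_mem hsr]
        exact (Finset.mem_insert.1 he).symm.imp_left (hM.1 e)
      · intro e he f hf v hv hv'
        rcases Finset.mem_insert.1 he with rfl | he <;>
          rcases Finset.mem_insert.1 hf with rfl | hf
        · rfl
        · exact absurd hv (hav f hf v hv')
        · exact absurd hv' (hav e he v hv)
        · exact hM.2 e he f hf v hv hv'
    · intro M hM
      rw [Finset.mem_filter, mem_edgeMatchings, not_not] at hM
      obtain ⟨hM, hsrM⟩ := hM
      rw [mem_edgeMatchings]
      refine ⟨?_, (hM.subset (Finset.erase_subset _ _)).2, ?_⟩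
      · intro e he
        rw [Finset.mem_erase] at he
        exact ((edgeSet_sup_edge_mem hsr e).1 (hM.1 e he.2)).resolve_right he.1
      · intro e he v hv hvR
        rw [Finset.mem_erase] at he
        exact he.1 (hM.2 e he.2 _ hsrM v hv (by simpa using hvR))
    · intro M hM
      rw [mem_edgeMatchings] at hM
      exact Finset.erase_insert fun h => hG (hM.1 _ h)
    · intro M hM
      rw [Finset.mem_filter, not_not] at hM
      exact Finset.insert_erase hM.2
    · intro M hM
      rw [mem_edgeMatchings] at hM
      rw [Finset.card_insert_of_notMem fun h => hG (hM.1 _ h), pow_succ']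

/-- The matching polynomials of two rooted graphs joined by an edge between their roots. -/
theorem matchingPoly_join {G₁ G₂ : SimpleGraph V} {S : Set V} {s r : V}
    (h₁ : ∀ a b, G₁.Adj a b → a ∈ S) (h₂ : ∀ a b, G₂.Adj a b → a ∉ S) (hs : s ∈ S) (hr : r ∉ S) :
    matchingPoly (G₁ ⊔ G₂ ⊔ SimpleGraph.edge s r) ∅ =
        matchingPoly G₁ ∅ * matchingPoly G₂ ∅ + X * (matchingPoly G₁ {s} * matchingPoly G₂ {r}) ∧
      matchingPoly (G₁ ⊔ G₂ ⊔ SimpleGraph.edge s r) {r} =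
        matchingPoly G₁ ∅ * matchingPoly G₂ {r} := by
  have hsr : s ≠ r := fun h => hr (h ▸ hs)
  have hadj : ¬ (G₁ ⊔ G₂).Adj s r := by
    rintro (h | h)
    · exact hr (h₁ r s h.symm)
    · exact h₂ s r h hs
  rw [matchingPoly_sup_edge hsr hadj, matchingPoly_sup_edge_of_mem hsr (Set.mem_singleton r),
    matchingPoly_sup h₁ h₂, matchingPoly_sup h₁ h₂, matchingPoly_sup h₁ h₂]
  -- Forbidding a vertex of the opposite side has no effect, since it is isolated in the graph at
  -- hand.
  have e₁ : matchingPoly G₁ {s, r} = matchingPoly G₁ {s} := matchingPoly_congr fun a b hab => by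
    have : a ≠ r := fun h => hr (h ▸ h₁ a b hab)
    simp [this]
  have e₂ : matchingPoly G₂ {s, r} = matchingPoly G₂ {r} := matchingPoly_congr fun a b hab => by
    have : a ≠ s := fun h => h₂ a b hab (h ▸ hs)
    simp [this]
  have e₃ : matchingPoly G₁ {r} = matchingPoly G₁ ∅ := matchingPoly_congr fun a b hab => by
    have : a ≠ r := fun h => hr (h ▸ h₁ a b hab)
    simp [this]
  rw [e₁, e₂, e₃]
  exact ⟨rfl, rfl⟩

theorem matchingPoly_bot (R : Set V) : matchingPoly (⊥ : SimpleGraph V) R = 1 := by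
  have : edgeMatchings (⊥ : SimpleGraph V) R = {∅} := by
    ext M
    rw [mem_edgeMatchings, Finset.mem_singleton]
    constructor
    · intro hM
      refine Finset.eq_empty_of_forall_notMem fun e he => ?_
      simpa using hM.1 e he
    · rintro rfl
      exact ⟨by simp, by simp, by simp⟩
  rw [matchingPoly, this]
  simp

/-- The degree is the matching number, so the top coefficient counts the edge sets of maximum
matchings. A matching subgraph has no isolated vertices and is therefore determined by its edge set.
-/
theorem numMaximumMatchings_eq (G : SimpleGraph V) :
    numMaximumMatchings G = (matchingPoly G ∅).leadingCoeff := by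
  classical
  have hof : ∀ M : G.Subgraph, M.IsMatching → IsEdgeMatching G ∅ M.edgeSet.toFinset := by
    intro M hM
    refine ⟨fun e he => M.edgeSet_subset (Set.mem_toFinset.1 he), ?_, by simp⟩
    intro e he f hf v hv hv'
    rw [Set.mem_toFinset] at he hf
    obtain ⟨w, rfl⟩ := Sym2.mem_iff_exists.1 hv
    obtain ⟨w', rfl⟩ := Sym2.mem_iff_exists.1 hv'
    rw [hM.eq_of_adj_left (SimpleGraph.Subgraph.mem_edgeSet.1 he)
      (SimpleGraph.Subgraph.mem_edgeSet.1 hf)]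
  have hto : ∀ N : Finset (Sym2 V), IsEdgeMatching G ∅ N →
      ∃ M : G.Subgraph, M.IsMatching ∧ M.edgeSet = N := by
    intro N hN
    refine ⟨⟨{v | ∃ w, s(v, w) ∈ N}, fun a b => s(a, b) ∈ N, fun h => hN.1 _ h,
      fun {a b} h => ⟨b, h⟩, ⟨fun a b h => by rwa [Sym2.eq_swap]⟩⟩, ?_, ?_⟩
    · rintro v ⟨w, hw⟩
      refine ⟨w, hw, fun w' hw' => ?_⟩
      have := hN.2 _ hw' _ hw v (Sym2.mem_mk_left _ _) (Sym2.mem_mk_left _ _)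
      exact Sym2.congr_right.1 this
    · ext e
      induction e with
      | _ a b => rfl
  have hcard : ∀ M : G.Subgraph, M.edgeSet.ncard = M.edgeSet.toFinset.card := fun M =>
    Set.ncard_eq_toFinset_card' _
  rw [leadingCoeff, coeff_matchingPoly, numMaximumMatchings, ← Set.ncard_coe_finset]
  refine Set.ncard_congr (fun M _ => M.edgeSet.toFinset) ?_ ?_ ?_
  · rintro M ⟨hM, hmax⟩
    rw [Finset.mem_coe, Finset.mem_filter, mem_edgeMatchings]
    refine ⟨hof M hM, le_antisymm (card_le_natDegree (hof M hM)) ?_⟩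
    obtain ⟨N, hN, hc⟩ := exists_card_eq_natDegree G ∅
    obtain ⟨M', hM', he⟩ := hto N hN
    have := hmax M' hM'
    rwa [he, Set.ncard_coe_finset, hc, hcard] at this
  · rintro M M' ⟨hM, _⟩ ⟨hM', _⟩ h
    exact SimpleGraph.Subgraph.IsMatching.injOn_edgeSet hM hM' (Set.toFinset_inj.1 h)
  · intro N hN
    rw [Finset.mem_coe, Finset.mem_filter, mem_edgeMatchings] at hN
    obtain ⟨M, hM, he⟩ := hto N hN.1
    refine ⟨M, ⟨hM, fun M' hM' => ?_⟩, ?_⟩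
    · rw [he, Set.ncard_coe_finset, hN.2, hcard]
      exact card_le_natDegree (hof M' hM')
    · ext e
      rw [Set.mem_toFinset, he, Finset.mem_coe]

end MatchingPolynomial
end TreeMatchings

namespace TreeMatchings

/-! ### Cutting and joining trees at an edge -/

section Cut

variable {V W : Type*}

theorem reachable_lift {H : SimpleGraph V} {K : SimpleGraph W} (φ : V → W)
    (h : ∀ a y, K.Adj (φ a) y → ∃ b, φ b = y ∧ H.Adj a b) {a : V} {w : W}
    (hr : K.Reachable (φ a) w) : ∃ b, φ b = w ∧ H.Reachable a b := by
  obtain ⟨p⟩ := hr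
  generalize hu : φ a = u at p
  induction p generalizing a with
  | nil => exact ⟨a, hu, .refl a⟩
  | cons hadj p ih =>
    subst hu
    obtain ⟨b, hb, hab⟩ := h a _ hadj
    obtain ⟨c, hc, hbc⟩ := ih hb
    exact ⟨c, hc, hab.reachable.trans hbc⟩

/-- A walk that starts in a set closed under adjacency never leaves it. This confines walks and
cycles to one side of a cut. -/
theorem edges_of_closed {H K : SimpleGraph V} {S : Set V}
    (h : ∀ a ∈ S, ∀ b, H.Adj a b → b ∈ S ∧ K.Adj a b) {u v : V} (p : H.Walk u v) (hu : u ∈ S) :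
    v ∈ S ∧ ∀ e ∈ p.edges, e ∈ K.edgeSet := by
  induction p with
  | nil => exact ⟨hu, by simp⟩
  | cons hadj p ih =>
    obtain ⟨hb, hK⟩ := h _ hu _ hadj
    obtain ⟨hv, he⟩ := ih hb
    refine ⟨hv, fun e hmem => ?_⟩
    rw [SimpleGraph.Walk.edges_cons, List.mem_cons] at hmem
    rcases hmem with rfl | hmem
    · exact hK
    · exact he e hmem

theorem reachable_of_closed {H K : SimpleGraph V} {S : Set V}
    (h : ∀ a ∈ S, ∀ b, H.Adj a b → b ∈ S ∧ K.Adj a b) {u v : V} (huv : H.Reachable u v)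
    (hu : u ∈ S) : v ∈ S ∧ K.Reachable u v := by
  obtain ⟨p⟩ := huv
  obtain ⟨hv, he⟩ := edges_of_closed h p hu
  exact ⟨hv, ⟨p.transfer K he⟩⟩

theorem isAcyclic_sup {G₁ G₂ : SimpleGraph V} {S : Set V} (h₁ : ∀ a b, G₁.Adj a b → a ∈ S)
    (h₂ : ∀ a b, G₂.Adj a b → a ∉ S) (a₁ : G₁.IsAcyclic) (a₂ : G₂.IsAcyclic) :
    (G₁ ⊔ G₂).IsAcyclic := by
  intro v c hc
  by_cases hv : v ∈ S
  · refine a₁ _ (hc.transfer (edges_of_closed (S := S) ?_ c hv).2)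
    rintro a ha b (hab | hab)
    · exact ⟨h₁ b a hab.symm, hab⟩
    · exact absurd ha (h₂ a b hab)
  · refine a₂ _ (hc.transfer (edges_of_closed (S := Sᶜ) ?_ c hv).2)
    rintro a ha b (hab | hab)
    · exact absurd (h₁ a b hab) ha
    · exact ⟨h₂ b a hab.symm, hab⟩

/-- All edges of `G` lie inside `S`, and they form a tree with vertex set `S`. -/
structure IsTreeOn (S : Finset V) (G : SimpleGraph V) : Prop where
  nonempty : S.Nonempty
  mem_of_adj : ∀ a b, G.Adj a b → a ∈ S
  reachable : ∀ a ∈ S, ∀ b ∈ S, G.Reachable a b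
  isAcyclic : G.IsAcyclic

theorem IsTreeOn.isTree_join [Fintype V] [DecidableEq V] {S : Finset V} {G₁ G₂ : SimpleGraph V}
    {s r : V} (h₁ : IsTreeOn S G₁) (h₂ : IsTreeOn Sᶜ G₂) (hs : s ∈ S) (hr : r ∈ Sᶜ) :
    (G₁ ⊔ G₂ ⊔ SimpleGraph.edge s r).IsTree := by
  have hsr : s ≠ r := fun h => Finset.mem_compl.1 hr (h ▸ hs)
  have m₂ : ∀ a b, G₂.Adj a b → a ∉ (S : Set V) := fun a b hab =>
    Finset.mem_compl.1 (h₂.mem_of_adj a b hab)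
  have hedge : (G₁ ⊔ G₂ ⊔ SimpleGraph.edge s r).Adj s r :=
    Or.inr ((SimpleGraph.edge_adj s r s r).2 ⟨Or.inl ⟨rfl, rfl⟩, hsr⟩)
  have hreach : ∀ v, (G₁ ⊔ G₂ ⊔ SimpleGraph.edge s r).Reachable s v := by
    intro v
    by_cases hv : v ∈ S
    · exact (h₁.reachable s hs v hv).mono (le_sup_left.trans le_sup_left)
    · exact hedge.reachable.trans ((h₂.reachable r hr v (Finset.mem_compl.2 hv)).mono
        (le_sup_right.trans le_sup_left))
  have : Nonempty V := ⟨s⟩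
  refine ⟨⟨fun u v => (hreach u).symm.trans (hreach v)⟩, ?_⟩
  -- An edge between two different components closes no cycle; `s` and `r` are separated because no
  -- edge of `G₁ ⊔ G₂` leaves `S`.
  refine SimpleGraph.IsAcyclic.sup_edge_of_not_reachable ?_
    (isAcyclic_sup (S := S) h₁.mem_of_adj m₂ h₁.isAcyclic h₂.isAcyclic)
  intro h
  refine Finset.mem_compl.1 hr (reachable_of_closed (K := G₁) (S := S) ?_ h hs).1
  rintro a ha b (hab | hab)
  · exact ⟨h₁.mem_of_adj b a hab.symm, hab⟩
  · exact absurd ha (m₂ a b hab)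

/-- Induction along a walk: traversing the deleted edge lands on `s` or `r`, and any other step
stays in the current component. -/
theorem reachable_or_reachable {T : SimpleGraph V} {s r u v : V} (h : T.Reachable u v)
    (hu : (T.deleteEdges {s(s, r)}).Reachable s u ∨ (T.deleteEdges {s(s, r)}).Reachable r u) :
    (T.deleteEdges {s(s, r)}).Reachable s v ∨ (T.deleteEdges {s(s, r)}).Reachable r v := by
  obtain ⟨p⟩ := h
  induction p with
  | nil => exact hu
  | @cons a b c hadj p ih =>
    refine ih ?_
    by_cases he : s(a, b) = s(s, r)
    · rcases Sym2.eq_iff.1 he with ⟨_, rfl⟩ | ⟨_, rfl⟩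
      · exact Or.inr (.refl _)
      · exact Or.inl (.refl _)
    · have : (T.deleteEdges {s(s, r)}).Adj a b := SimpleGraph.deleteEdges_adj.2 ⟨hadj, by simpa using he⟩
      exact hu.imp (·.trans this.reachable) (·.trans this.reachable)

open Classical in
/-- The vertices that stay connected to `s` when the edge `s r` is deleted. -/
noncomputable def side [Fintype V] (T : SimpleGraph V) (s r : V) : Finset V :=
  Finset.univ.filter fun v => (T.deleteEdges {s(s, r)}).Reachable s v

/-- The edges of `T` inside `S`, as a graph on all vertices. -/
def restrict (T : SimpleGraph V) (S : Finset V) : SimpleGraph V where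
  Adj a b := T.Adj a b ∧ a ∈ S ∧ b ∈ S
  symm := ⟨fun _ _ h => ⟨h.1.symm, h.2.2, h.2.1⟩⟩
  loopless := ⟨fun _ h => h.1.ne rfl⟩

theorem restrict_le (T : SimpleGraph V) (S : Finset V) : restrict T S ≤ T := fun _ _ h => h.1

variable [Fintype V]

theorem mem_side {T : SimpleGraph V} {s r v : V} :
    v ∈ side T s r ↔ (T.deleteEdges {s(s, r)}).Reachable s v := by
  classical
  simp [side]

theorem self_mem_side (T : SimpleGraph V) (s r : V) : s ∈ side T s r :=
  mem_side.2 (.refl s)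

theorem root_notMem_side {T : SimpleGraph V} (hT : T.IsTree) {s r : V} (hsr : T.Adj s r) :
    r ∉ side T s r := by
  rw [mem_side]
  exact SimpleGraph.isBridge_iff.1
    (SimpleGraph.isAcyclic_iff_forall_adj_isBridge.1 hT.isAcyclic hsr)

theorem reachable_root_of_notMem_side {T : SimpleGraph V} (hT : T.IsTree) {s r v : V}
    (hv : v ∉ side T s r) : (T.deleteEdges {s(s, r)}).Reachable r v := by
  rw [mem_side] at hv
  exact (reachable_or_reachable (hT.connected.preconnected s v) (Or.inl (.refl s))).resolve_left hv

theorem mem_side_of_adj {T : SimpleGraph V} {s r a b : V}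
    (hab : (T.deleteEdges {s(s, r)}).Adj a b) (ha : a ∈ side T s r) : b ∈ side T s r :=
  mem_side.2 ((mem_side.1 ha).trans hab.reachable)

theorem isTreeOn_restrict_side {T : SimpleGraph V} (hT : T.IsTree) (s r : V) :
    IsTreeOn (side T s r) (restrict T (side T s r)) := by
  have key : ∀ v ∈ side T s r, (restrict T (side T s r)).Reachable s v := by
    intro v hv
    refine (reachable_of_closed (S := (side T s r : Set V)) ?_ (mem_side.1 hv)
      (self_mem_side T s r)).2
    intro a ha b hab
    have hb := mem_side_of_adj hab ha
    exact ⟨hb, (SimpleGraph.deleteEdges_adj.1 hab).1, ha, hb⟩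
  exact ⟨⟨s, self_mem_side T s r⟩, fun a b h => h.2.1,
    fun a ha b hb => (key a ha).symm.trans (key b hb), hT.isAcyclic.anti (restrict_le _ _)⟩

/-- The witness is the second vertex of the path from `r` to `v`: the rest of the path never returns
to `r`, so it survives deletion of the first edge. -/
theorem exists_mem_side {T : SimpleGraph V} (hT : T.IsTree) {r v : V} (hv : v ≠ r) :
    ∃ s, T.Adj s r ∧ v ∈ side T s r := by
  obtain ⟨p, hp⟩ := (hT.existsUnique_path r v).exists
  cases p with
  | nil => exact absurd rfl hv
  | @cons _ s _ hadj p =>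
    rw [SimpleGraph.Walk.cons_isPath_iff] at hp
    refine ⟨s, hadj.symm, mem_side.2 ⟨p.transfer _ fun e he => ?_⟩⟩
    rw [SimpleGraph.edgeSet_deleteEdges]
    refine ⟨p.edges_subset_edgeSet he, fun h => hp.2 ?_⟩
    rw [Set.mem_singleton_iff] at h
    subst h
    exact p.snd_mem_support_of_mem_edges he

variable [DecidableEq V]

theorem isTreeOn_restrict_side_compl {T : SimpleGraph V} (hT : T.IsTree) {s r : V}
    (hsr : T.Adj s r) : IsTreeOn (side T s r)ᶜ (restrict T (side T s r)ᶜ) := by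
  have hr : r ∈ (side T s r)ᶜ := Finset.mem_compl.2 (root_notMem_side hT hsr)
  have key : ∀ v ∈ (side T s r)ᶜ, (restrict T (side T s r)ᶜ).Reachable r v := by
    intro v hv
    refine (reachable_of_closed (S := ((side T s r)ᶜ : Finset V)) ?_
      (reachable_root_of_notMem_side hT (Finset.mem_compl.1 hv)) hr).2
    intro a ha b hab
    have hb : b ∈ (side T s r)ᶜ := Finset.mem_compl.2 fun hb =>
      Finset.mem_compl.1 ha (mem_side_of_adj hab.symm hb)
    exact ⟨hb, (SimpleGraph.deleteEdges_adj.1 hab).1, ha, hb⟩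
  exact ⟨⟨r, hr⟩, fun a b h => h.2.1,
    fun a ha b hb => (key a ha).symm.trans (key b hb), hT.isAcyclic.anti (restrict_le _ _)⟩

theorem restrict_sup_restrict {T : SimpleGraph V} {s r : V} (hsr : T.Adj s r) :
    restrict T (side T s r) ⊔ restrict T (side T s r)ᶜ ⊔ SimpleGraph.edge s r = T := by
  refine le_antisymm (sup_le (sup_le (restrict_le _ _) (restrict_le _ _)) ?_) ?_
  · intro a b hab
    rw [SimpleGraph.edge_adj] at hab
    rcases hab.1 with ⟨rfl, rfl⟩ | ⟨rfl, rfl⟩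
    · exact hsr
    · exact hsr.symm
  · intro a b hab
    by_cases he : s(a, b) = s(s, r)
    · exact Or.inr ((SimpleGraph.edge_adj s r a b).2 ⟨Sym2.eq_iff.1 he, hab.ne⟩)
    · have hab' : (T.deleteEdges {s(s, r)}).Adj a b := SimpleGraph.deleteEdges_adj.2 ⟨hab, by simpa using he⟩
      refine Or.inl ?_
      by_cases ha : a ∈ side T s r
      · exact Or.inl ⟨hab, ha, mem_side_of_adj hab' ha⟩
      · exact Or.inr ⟨hab, Finset.mem_compl.2 ha, Finset.mem_compl.2 fun hb =>
          ha (mem_side_of_adj hab'.symm hb)⟩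

section Join

variable {S : Finset V} {G₁ G₂ : SimpleGraph V} {s r : V}

theorem side_join (h₁ : IsTreeOn S G₁) (h₂ : IsTreeOn Sᶜ G₂) (hs : s ∈ S) (hr : r ∈ Sᶜ) :
    side (G₁ ⊔ G₂ ⊔ SimpleGraph.edge s r) s r = S := by
  ext v
  rw [mem_side]
  constructor
  · intro h
    refine (reachable_of_closed (K := ⊤) (S := (S : Set V)) ?_ h hs).1
    intro a ha b hab
    rw [SimpleGraph.deleteEdges_adj] at hab
    refine ⟨?_, hab.1.ne⟩
    rcases hab.1 with (h | h) | h
    · exact h₁.mem_of_adj b a h.symm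
    · exact absurd ha (Finset.mem_compl.1 (h₂.mem_of_adj a b h))
    · exact absurd (Set.mem_singleton_iff.2 (Sym2.eq_iff.2 ((SimpleGraph.edge_adj s r a b).1 h).1)) hab.2
  · intro hv
    refine (h₁.reachable s hs v hv).mono fun a b hab => ?_
    rw [SimpleGraph.deleteEdges_adj]
    refine ⟨Or.inl (Or.inl hab), fun h => ?_⟩
    have ha := h₁.mem_of_adj a b hab
    have hb := h₁.mem_of_adj b a hab.symm
    rcases Sym2.eq_iff.1 (Set.mem_singleton_iff.1 h) with ⟨rfl, rfl⟩ | ⟨rfl, rfl⟩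
    · exact Finset.mem_compl.1 hr hb
    · exact Finset.mem_compl.1 hr ha

theorem restrict_join_left (h₁ : IsTreeOn S G₁) (h₂ : IsTreeOn Sᶜ G₂) (hr : r ∈ Sᶜ) :
    restrict (G₁ ⊔ G₂ ⊔ SimpleGraph.edge s r) S = G₁ := by
  ext a b
  constructor
  · rintro ⟨(h | h) | h, ha, hb⟩
    · exact h
    · exact absurd ha (Finset.mem_compl.1 (h₂.mem_of_adj a b h))
    · rcases ((SimpleGraph.edge_adj s r a b).1 h).1 with ⟨rfl, rfl⟩ | ⟨rfl, rfl⟩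
      · exact absurd hb (Finset.mem_compl.1 hr)
      · exact absurd ha (Finset.mem_compl.1 hr)
  · exact fun h => ⟨Or.inl (Or.inl h), h₁.mem_of_adj a b h, h₁.mem_of_adj b a h.symm⟩

theorem restrict_join_right (h₁ : IsTreeOn S G₁) (h₂ : IsTreeOn Sᶜ G₂) (hs : s ∈ S) :
    restrict (G₁ ⊔ G₂ ⊔ SimpleGraph.edge s r) Sᶜ = G₂ := by
  ext a b
  constructor
  · rintro ⟨(h | h) | h, ha, hb⟩
    · exact absurd (h₁.mem_of_adj a b h) (Finset.mem_compl.1 ha)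
    · exact h
    · rcases ((SimpleGraph.edge_adj s r a b).1 h).1 with ⟨rfl, rfl⟩ | ⟨rfl, rfl⟩
      · exact absurd hs (Finset.mem_compl.1 ha)
      · exact absurd hs (Finset.mem_compl.1 hb)
  · exact fun h => ⟨Or.inl (Or.inr h), h₂.mem_of_adj a b h, h₂.mem_of_adj b a h.symm⟩

end Join

open Classical in
/-- Cutting a tree at an oriented edge is a bijection onto pairs of rooted trees on complementary
vertex sets. -/
theorem sum_oriented_edges {M : Type*} [AddCommMonoid M]
    (Φ : Finset V → SimpleGraph V → V → V → M) :
    ∑ T : SimpleGraph V with T.IsTree, ∑ r, ∑ s with T.Adj s r, Φ (side T s r) T s r =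
      ∑ S : Finset V, ∑ G₁ with IsTreeOn S G₁, ∑ s ∈ S, ∑ G₂ with IsTreeOn Sᶜ G₂, ∑ r ∈ Sᶜ,
        Φ S (G₁ ⊔ G₂ ⊔ SimpleGraph.edge s r) s r := by
  simp only [Finset.sum_sigma']
  refine Finset.sum_bij'
    (fun p _ => ⟨side p.1 p.2.2 p.2.1, restrict p.1 (side p.1 p.2.2 p.2.1), p.2.2,
      restrict p.1 (side p.1 p.2.2 p.2.1)ᶜ, p.2.1⟩)
    (fun q _ => ⟨q.2.1 ⊔ q.2.2.2.1 ⊔ SimpleGraph.edge q.2.2.1 q.2.2.2.2,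
      q.2.2.2.2, q.2.2.1⟩) ?_ ?_ ?_ ?_ ?_
  · rintro ⟨T, r, s⟩ hp
    simp only [Finset.mem_sigma, Finset.mem_filter, Finset.mem_univ, true_and] at hp ⊢
    exact ⟨isTreeOn_restrict_side hp.1 s r, self_mem_side T s r,
      isTreeOn_restrict_side_compl hp.1 hp.2, Finset.mem_compl.2 (root_notMem_side hp.1 hp.2)⟩
  · rintro ⟨S, G₁, s, G₂, r⟩ hq
    simp only [Finset.mem_sigma, Finset.mem_filter, Finset.mem_univ, true_and] at hq ⊢
    obtain ⟨h₁, hs, h₂, hr⟩ := hq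
    exact ⟨h₁.isTree_join h₂ hs hr, Or.inr ((SimpleGraph.edge_adj s r s r).2
      ⟨Or.inl ⟨rfl, rfl⟩, fun h => Finset.mem_compl.1 hr (h ▸ hs)⟩)⟩
  · rintro ⟨T, r, s⟩ hp
    simp only [Finset.mem_sigma, Finset.mem_filter, Finset.mem_univ, true_and] at hp ⊢
    rw [restrict_sup_restrict hp.2]
  · rintro ⟨S, G₁, s, G₂, r⟩ hq
    simp only [Finset.mem_sigma, Finset.mem_filter, Finset.mem_univ, true_and] at hq ⊢
    obtain ⟨h₁, hs, h₂, hr⟩ := hq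
    rw [side_join h₁ h₂ hs hr, restrict_join_left h₁ h₂ hr, restrict_join_right h₁ h₂ hs]
  · rintro ⟨T, r, s⟩ hp
    simp only [Finset.mem_sigma, Finset.mem_filter, Finset.mem_univ, true_and] at hp ⊢
    rw [restrict_sup_restrict hp.2]

/-- Prefixing `r` to a path from `s` to `v` inside the branch gives the unique path from `r` to `v`.
Hence distinct branches are disjoint. -/
theorem snd_eq_of_mem_side {T : SimpleGraph V} (hT : T.IsTree) {s r v : V} (hsr : T.Adj s r)
    (hv : v ∈ side T s r) {p : T.Walk r v} (hp : p.IsPath) : p.snd = s := by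
  obtain ⟨q, hq⟩ := (mem_side.1 hv).exists_isPath
  have hr : r ∉ q.support := fun h =>
    root_notMem_side hT hsr (mem_side.2 (q.takeUntil r h).reachable)
  have hq' := hq.mapLe (SimpleGraph.deleteEdges_le (G := T) {s(s, r)})
  have hpath : (SimpleGraph.Walk.cons hsr.symm
      (q.mapLe (SimpleGraph.deleteEdges_le (G := T) {s(s, r)}))).IsPath := by
    rw [SimpleGraph.Walk.cons_isPath_iff]
    exact ⟨hq', by simpa using hr⟩
  rw [(hT.existsUnique_path r v).unique hp hpath, SimpleGraph.Walk.snd_cons]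

open Classical in
/-- The branches at a vertex of a tree contain all other vertices once. -/
theorem sum_card_side {T : SimpleGraph V} (hT : T.IsTree) (r : V) :
    ∑ s with T.Adj s r, (side T s r).card = Fintype.card V - 1 := by
  rw [← Finset.card_univ, ← Finset.card_erase_of_mem (Finset.mem_univ r), ← Finset.card_biUnion]
  · congr 1
    ext v
    simp only [Finset.mem_biUnion, Finset.mem_filter, Finset.mem_univ, true_and, Finset.mem_erase,
      and_true]
    constructor
    · rintro ⟨s, hs, hv⟩ rfl
      exact root_notMem_side hT hs hv
    · exact fun hv => exists_mem_side hT hv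
  · intro s hs s' hs' hne
    rw [Finset.coe_filter, Set.mem_ofPred_eq] at hs hs'
    refine Finset.disjoint_left.2 fun v hv hv' => hne ?_
    obtain ⟨p, hp⟩ := (hT.existsUnique_path r v).exists
    rw [← snd_eq_of_mem_side hT hs.2 hv hp, snd_eq_of_mem_side hT hs'.2 hv' hp]

end Cut

/-! ### Relabelling trees on a vertex subset -/

section Relabel

variable {V W : Type*}

theorem isTreeOn_map [Fintype V] [Nonempty V] {G : SimpleGraph V} (hG : G.IsTree) (φ : V ↪ W) :
    IsTreeOn (Finset.univ.map φ) (G.map φ) := by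
  refine ⟨by simp, ?_, ?_, ?_⟩
  · intro a b hab
    obtain ⟨_, u, v, _, rfl, rfl⟩ := hab
    simp
  · intro a ha b hb
    obtain ⟨u, _, rfl⟩ := Finset.mem_map.1 ha
    obtain ⟨v, _, rfl⟩ := Finset.mem_map.1 hb
    exact (hG.connected.preconnected u v).map (SimpleGraph.Embedding.map φ G).toHom
  -- Every edge of the image is a bridge: a detour around it would lift along `φ` to a detour around
  -- an edge of `G`.
  · rw [SimpleGraph.isAcyclic_iff_forall_adj_isBridge]
    intro a b hab
    obtain ⟨_, u, v, huv, rfl, rfl⟩ := hab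
    rw [SimpleGraph.isBridge_iff]
    intro h
    obtain ⟨w, hw, hr⟩ := reachable_lift (H := G.deleteEdges {s(u, v)}) φ (fun a y hay => by
      rw [SimpleGraph.deleteEdges_adj] at hay
      obtain ⟨⟨_, a', b, hab, ha, rfl⟩, hne⟩ := hay
      rw [φ.injective ha] at hab
      refine ⟨b, rfl, SimpleGraph.deleteEdges_adj.2 ⟨hab, fun h => hne ?_⟩⟩
      rw [Set.mem_singleton_iff] at h ⊢
      exact congrArg (Sym2.map φ) h) h
    rw [φ.injective hw] at hr
    exact SimpleGraph.isBridge_iff.1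
      (SimpleGraph.isAcyclic_iff_forall_adj_isBridge.1 hG.isAcyclic huv) hr

theorem isTree_comap [Fintype V] {S : Finset W} {G : SimpleGraph W} (hG : IsTreeOn S G)
    (φ : V ↪ W) (hS : Finset.univ.map φ = S) : (G.comap φ).IsTree := by
  subst hS
  have hmem : ∀ v, φ v ∈ Finset.univ.map φ := fun v => by simp
  have : Nonempty V := by
    obtain ⟨w, hw⟩ := hG.nonempty
    obtain ⟨v, _, _⟩ := Finset.mem_map.1 hw
    exact ⟨v⟩
  refine ⟨⟨fun u v => ?_⟩, hG.isAcyclic.of_comap φ⟩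
  obtain ⟨w, hw, hr⟩ := reachable_lift (H := G.comap φ) φ (fun a y hay => by
    obtain ⟨b, _, rfl⟩ := Finset.mem_map.1 (hG.mem_of_adj y _ hay.symm)
    exact ⟨b, rfl, hay⟩) (hG.reachable _ (hmem u) _ (hmem v))
  rwa [φ.injective hw] at hr

theorem map_comap_of_isTreeOn [Fintype V] {S : Finset W} {G : SimpleGraph W} (hG : IsTreeOn S G)
    (φ : V ↪ W) (hS : Finset.univ.map φ = S) : (G.comap φ).map φ = G := by
  subst hS
  refine le_antisymm (SimpleGraph.map_comap_le φ G) ?_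
  intro a b hab
  obtain ⟨u, _, rfl⟩ := Finset.mem_map.1 (hG.mem_of_adj a b hab)
  obtain ⟨v, _, rfl⟩ := Finset.mem_map.1 (hG.mem_of_adj b _ hab.symm)
  exact ⟨hab.ne, u, v, hab, rfl, rfl⟩

open Polynomial

/-- The sum of `w f g` over all labeled rooted trees with `n` vertices, where `f` and `g` are the
generating polynomials of all matchings and of those avoiding the root. -/
noncomputable def rootedTotal (w : ℕ[X] → ℕ[X] → ℚ) (n : ℕ) : ℚ := by
  classical
  exact ∑ T : SimpleGraph (Fin n) with T.IsTree, ∑ r, w (matchingPoly T ∅) (matchingPoly T {r})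

open Classical in
theorem sum_isTreeOn_map [Fintype W] [DecidableEq W] {k : ℕ} (φ : Fin k ↪ W) (w : ℕ[X] → ℕ[X] → ℚ) :
    ∑ G with IsTreeOn (Finset.univ.map φ) G, ∑ r ∈ Finset.univ.map φ,
      w (matchingPoly G ∅) (matchingPoly G {r}) = rootedTotal w k := by
  rw [rootedTotal]
  symm
  refine Finset.sum_bij' (fun G _ => G.map φ) (fun G _ => G.comap φ) ?_ ?_ ?_ ?_ ?_
  · intro G hG
    rw [Finset.mem_filter] at hG ⊢
    have := hG.2.connected.nonempty
    exact ⟨Finset.mem_univ _, isTreeOn_map hG.2 φ⟩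
  · intro G hG
    rw [Finset.mem_filter] at hG ⊢
    exact ⟨Finset.mem_univ _, isTree_comap hG.2 φ rfl⟩
  · intro G _
    exact SimpleGraph.comap_map_eq φ G
  · intro G hG
    exact map_comap_of_isTreeOn (Finset.mem_filter.1 hG).2 φ rfl
  · intro G _
    rw [Finset.sum_map]
    refine Finset.sum_congr rfl fun r _ => ?_
    rw [matchingPoly_map, matchingPoly_map, Set.preimage_empty]
    congr 2
    ext x
    simp

open Classical in
theorem sum_isTreeOn [Fintype W] [DecidableEq W] (S : Finset W) (w : ℕ[X] → ℕ[X] → ℚ) :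
    ∑ G with IsTreeOn S G, ∑ r ∈ S, w (matchingPoly G ∅) (matchingPoly G {r}) =
      rootedTotal w S.card := by
  let φ : Fin S.card ↪ W := S.equivFin.symm.toEmbedding.trans (Function.Embedding.subtype _)
  have hS : Finset.univ.map φ = S := by
    ext x
    simp only [Finset.mem_map, Finset.mem_univ, true_and]
    constructor
    · rintro ⟨i, rfl⟩
      exact (S.equivFin.symm i).2
    · intro hx
      exact ⟨S.equivFin ⟨x, hx⟩, by simp [φ]⟩
  have h := sum_isTreeOn_map φ w
  rwa [hS] at h

end Relabel
end TreeMatchings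

namespace TreeMatchings

/-! ### Generating functions of rooted trees -/

open PowerSeries Polynomial

/-- The exponential generating function of a sequence. -/
noncomputable def egf (a : ℕ → ℚ) : ℚ⟦X⟧ := PowerSeries.mk fun n => a n / n.factorial

theorem euler_egf (a : ℕ → ℚ) : euler (egf a) = egf fun n => n * a n := by
  ext n
  rw [coeff_euler, egf, egf, coeff_mk, coeff_mk, mul_div_assoc]

theorem sum_finset_card (n : ℕ) (φ : ℕ → ℚ) :
    ∑ S : Finset (Fin n), φ S.card = ∑ k ∈ Finset.range (n + 1), n.choose k * φ k := by
  have h := Finset.sum_powerset_apply_card φ (x := (Finset.univ : Finset (Fin n)))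
  rw [Finset.powerset_univ, Finset.card_univ, Fintype.card_fin] at h
  rw [h]
  exact Finset.sum_congr rfl fun k _ => nsmul_eq_mul _ _

theorem coeff_egf_mul (a b : ℕ → ℚ) (n : ℕ) :
    coeff n (egf a * egf b) =
      (∑ S : Finset (Fin n), a S.card * b (n - S.card)) / n.factorial := by
  rw [sum_finset_card n fun k => a k * b (n - k), PowerSeries.coeff_mul,
    Finset.Nat.sum_antidiagonal_eq_sum_range_succ_mk, Finset.sum_div]
  refine Finset.sum_congr rfl fun k hk => ?_
  have hkn : k ≤ n := Nat.lt_succ_iff.1 (Finset.mem_range.1 hk)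
  have h : (n.choose k : ℚ) * k.factorial * (n - k).factorial = n.factorial := by
    exact_mod_cast Nat.choose_mul_factorial_mul_factorial hkn
  have h₁ : (k.factorial : ℚ) ≠ 0 := by exact_mod_cast k.factorial_ne_zero
  have h₂ : ((n - k).factorial : ℚ) ≠ 0 := by exact_mod_cast (n - k).factorial_ne_zero
  have h₃ : (n.factorial : ℚ) ≠ 0 := by exact_mod_cast n.factorial_ne_zero
  rw [egf, egf, coeff_mk, coeff_mk, div_mul_div_comm, div_eq_div_iff (mul_ne_zero h₁ h₂) h₃, ← h]
  ring

/-- The properties of the pair of matching polynomials of a rooted graph that determine how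
maximum matchings behave under joining. -/
structure Admissible (f g : ℕ[X]) : Prop where
  left_ne_zero : f ≠ 0
  right_ne_zero : g ≠ 0
  natDegree_le : g.natDegree ≤ f.natDegree
  natDegree_le_succ : f.natDegree ≤ g.natDegree + 1

theorem admissible_matchingPoly {V : Type*} [Fintype V] (G : SimpleGraph V) (r : V) :
    Admissible (matchingPoly G ∅) (matchingPoly G {r}) :=
  ⟨matchingPoly_ne_zero G _, matchingPoly_ne_zero G _, natDegree_matchingPoly_singleton_le G r,
    natDegree_matchingPoly_le_succ G r⟩

open Classical in
-- Writing the weight of a join as a finite sum of products lets the sum over pairs of rooted trees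
-- factor. The function `c` of the branch size is later taken to be the size itself or the constant
-- 1.
theorem sum_cut {ι : Type*} [Fintype ι] (c : ℕ → ℚ) (h : ℕ[X] → ℕ[X] → ℚ)
    (u v : ι → ℕ[X] → ℕ[X] → ℚ)
    (hh : ∀ f₁ g₁ f₂ g₂, Admissible f₁ g₁ → Admissible f₂ g₂ →
      h (f₁ * f₂ + Polynomial.X * (g₁ * g₂)) (f₁ * g₂) = ∑ i, u i f₁ g₁ * v i f₂ g₂) (n : ℕ) :
    ∑ T : SimpleGraph (Fin n) with T.IsTree, ∑ r, ∑ s with T.Adj s r,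
        c (side T s r).card * h (matchingPoly T ∅) (matchingPoly T {r}) =
      ∑ i, ∑ S : Finset (Fin n),
        c S.card * rootedTotal (u i) S.card * rootedTotal (v i) (n - S.card) := by
  have key := sum_oriented_edges (V := Fin n) fun S T _ r =>
    c S.card * h (matchingPoly T ∅) (matchingPoly T {r})
  refine Eq.trans ?_ (key.trans ?_)
  · congr!
  rw [Finset.sum_comm]
  refine Finset.sum_congr rfl fun S _ => ?_
  have hc : n - S.card = Sᶜ.card := by rw [Finset.card_compl, Fintype.card_fin]
  have hterm : ∀ G₁ : SimpleGraph (Fin n), IsTreeOn S G₁ → ∀ s ∈ S,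
      ∀ G₂ : SimpleGraph (Fin n), IsTreeOn Sᶜ G₂ → ∀ r ∈ Sᶜ,
      c S.card * h (matchingPoly (G₁ ⊔ G₂ ⊔ SimpleGraph.edge s r) ∅)
        (matchingPoly (G₁ ⊔ G₂ ⊔ SimpleGraph.edge s r) {r}) =
      ∑ i, c S.card * (u i (matchingPoly G₁ ∅) (matchingPoly G₁ {s}) *
        v i (matchingPoly G₂ ∅) (matchingPoly G₂ {r})) := by
    intro G₁ h₁ s hs G₂ h₂ r hr
    obtain ⟨e₁, e₂⟩ := matchingPoly_join (S := (S : Set (Fin n))) (s := s) (r := r) h₁.mem_of_adj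
      (fun a b hab => Finset.mem_compl.1 (h₂.mem_of_adj a b hab)) hs (Finset.mem_compl.1 hr)
    rw [e₁, e₂, hh _ _ _ _ (admissible_matchingPoly G₁ s) (admissible_matchingPoly G₂ r),
      Finset.mul_sum]
  calc _ = ∑ G₁ with IsTreeOn S G₁, ∑ s ∈ S, ∑ G₂ with IsTreeOn Sᶜ G₂, ∑ r ∈ Sᶜ,
        ∑ i, c S.card * (u i (matchingPoly G₁ ∅) (matchingPoly G₁ {s}) *
          v i (matchingPoly G₂ ∅) (matchingPoly G₂ {r})) := by
        refine Finset.sum_congr rfl fun G₁ h₁ => Finset.sum_congr rfl fun s hs =>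
          Finset.sum_congr rfl fun G₂ h₂ => Finset.sum_congr rfl fun r hr => ?_
        exact hterm G₁ (Finset.mem_filter.1 h₁).2 s hs G₂ (Finset.mem_filter.1 h₂).2 r hr
    _ = ∑ i, c S.card * (∑ G₁ with IsTreeOn S G₁, ∑ s ∈ S,
          u i (matchingPoly G₁ ∅) (matchingPoly G₁ {s})) *
          (∑ G₂ with IsTreeOn Sᶜ G₂, ∑ r ∈ Sᶜ,
            v i (matchingPoly G₂ ∅) (matchingPoly G₂ {r})) := by
        simp only [Finset.sum_comm (t := (Finset.univ : Finset ι))]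
        refine Finset.sum_congr rfl fun i _ => ?_
        rw [mul_assoc]
        simp only [Finset.sum_mul]
        simp only [Finset.mul_sum]
    _ = _ := by
        refine Finset.sum_congr rfl fun i _ => ?_
        rw [sum_isTreeOn, sum_isTreeOn, hc]

open Classical in
theorem rootedTotal_eq (w : ℕ[X] → ℕ[X] → ℚ) (n : ℕ) : rootedTotal w n =
    ∑ T : SimpleGraph (Fin n) with T.IsTree, ∑ r,
      w (matchingPoly T ∅) (matchingPoly T {r}) := rfl

theorem rootedTotal_zero (w : ℕ[X] → ℕ[X] → ℚ) : rootedTotal w 0 = 0 := by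
  classical
  rw [rootedTotal_eq]
  exact Finset.sum_eq_zero fun T _ => by simp

theorem rootedTotal_one (w : ℕ[X] → ℕ[X] → ℚ) : rootedTotal w 1 = w 1 1 := by
  classical
  rw [rootedTotal_eq]
  have : (Finset.univ.filter fun T : SimpleGraph (Fin 1) => T.IsTree) = {⊥} := by
    ext T
    have hT : T = ⊥ := Subsingleton.elim _ _
    subst hT
    simpa using SimpleGraph.IsTree.of_subsingleton (G := (⊥ : SimpleGraph (Fin 1)))
  rw [this, Finset.sum_singleton]
  simp [matchingPoly_bot]

/-- With `c k = k`, each rooted tree is counted once for every non-root vertex, that is n - 1 times.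
The branch size appears as `euler` on the first factor. -/
theorem euler_egf_rootedTotal {ι : Type*} [Fintype ι] (h : ℕ[X] → ℕ[X] → ℚ)
    (u v : ι → ℕ[X] → ℕ[X] → ℚ)
    (hh : ∀ f₁ g₁ f₂ g₂, Admissible f₁ g₁ → Admissible f₂ g₂ →
      h (f₁ * f₂ + Polynomial.X * (g₁ * g₂)) (f₁ * g₂) = ∑ i, u i f₁ g₁ * v i f₂ g₂) :
    euler (egf (rootedTotal h)) - egf (rootedTotal h) =
      ∑ i, euler (egf (rootedTotal (u i))) * egf (rootedTotal (v i)) := by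
  classical
  ext n
  rw [map_sub, map_sum]
  simp only [euler_egf, coeff_egf_mul]
  rw [← Finset.sum_div, ← sum_cut (fun k => (k : ℚ)) h u v hh n, egf, egf, coeff_mk, coeff_mk,
    ← sub_div]
  congr 1
  rcases Nat.eq_zero_or_pos n with rfl | hn
  · rw [rootedTotal_zero]
    simp
  · rw [show (n : ℚ) * rootedTotal h n - rootedTotal h n = ((n : ℚ) - 1) * rootedTotal h n by ring,
      rootedTotal_eq, Finset.mul_sum]
    refine Finset.sum_congr rfl fun T hT => ?_
    rw [Finset.mul_sum]
    refine Finset.sum_congr rfl fun r _ => ?_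
    rw [← Finset.sum_mul]
    congr 1
    have := sum_card_side (Finset.mem_filter.1 hT).2 r
    rw [Fintype.card_fin] at this
    rw [← Nat.cast_sum, ← Nat.cast_pred hn]
    exact_mod_cast this.symm

/-- Leading coefficient of `f` for rooted trees all of whose maximum matchings cover the root. -/
noncomputable def weightA (f g : ℕ[X]) : ℚ :=
  if g.natDegree < f.natDegree then f.leadingCoeff else 0

/-- Leading coefficient of `f` for rooted trees with a maximum matching avoiding the root. -/
noncomputable def weightB (f g : ℕ[X]) : ℚ :=
  if g.natDegree < f.natDegree then 0 else f.leadingCoeff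

/-- Leading coefficient of `g` for rooted trees with a maximum matching avoiding the root. -/
noncomputable def weightC (f g : ℕ[X]) : ℚ :=
  if g.natDegree < f.natDegree then 0 else g.leadingCoeff

/-- Leading coefficient of `g` for rooted trees all of whose maximum matchings cover the root. -/
noncomputable def weightD (f g : ℕ[X]) : ℚ :=
  if g.natDegree < f.natDegree then g.leadingCoeff else 0

/-- Natural-number coefficients cannot cancel. -/
theorem natDegree_add_of_natDegree_eq {p q : ℕ[X]} (hp : p ≠ 0)
    (h : p.natDegree = q.natDegree) :
    (p + q).natDegree = p.natDegree ∧
      (p + q).leadingCoeff = p.leadingCoeff + q.leadingCoeff := by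
  have hc : (p + q).coeff p.natDegree = p.leadingCoeff + q.leadingCoeff := by
    rw [Polynomial.coeff_add, leadingCoeff, leadingCoeff, h]
  have hd : (p + q).natDegree = p.natDegree := by
    refine le_antisymm ((natDegree_add_le p q).trans (by rw [← h, max_self])) ?_
    refine le_natDegree_of_ne_zero ?_
    rw [hc]
    have := leadingCoeff_ne_zero.2 hp
    omega
  exact ⟨hd, by rw [leadingCoeff, hd, hc]⟩

theorem natDegree_add_of_natDegree_lt {p q : ℕ[X]} (h : q.natDegree < p.natDegree) :
    (p + q).natDegree = p.natDegree ∧ (p + q).leadingCoeff = p.leadingCoeff :=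
  ⟨natDegree_add_eq_left_of_natDegree_lt h,
    leadingCoeff_add_of_degree_lt' (degree_lt_degree h)⟩

section Weights

variable {f₁ g₁ f₂ g₂ : ℕ[X]}

/-- Compare deg f₁f₂ with deg X g₁g₂, where deg f - deg g is 0 or 1 on each side. If both
differences are 1 the first term dominates, if both are 0 the second does, and otherwise the degrees
tie and the leading coefficients add. Comparison with deg f₁g₂ gives the class of the join. -/
theorem weights_join (h₁ : Admissible f₁ g₁) (h₂ : Admissible f₂ g₂) :
    weightA (f₁ * f₂ + Polynomial.X * (g₁ * g₂)) (f₁ * g₂) =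
        weightA f₁ g₁ * weightA f₂ g₂ + weightB f₁ g₁ * weightA f₂ g₂
          + weightC f₁ g₁ * weightD f₂ g₂ + weightC f₁ g₁ * weightC f₂ g₂ ∧
      weightB (f₁ * f₂ + Polynomial.X * (g₁ * g₂)) (f₁ * g₂) =
        weightA f₁ g₁ * weightB f₂ g₂ + weightD f₁ g₁ * weightC f₂ g₂ ∧
      weightC (f₁ * f₂ + Polynomial.X * (g₁ * g₂)) (f₁ * g₂) = weightA f₁ g₁ * weightC f₂ g₂ ∧
      weightD (f₁ * f₂ + Polynomial.X * (g₁ * g₂)) (f₁ * g₂) =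
        weightA f₁ g₁ * weightD f₂ g₂ + weightB f₁ g₁ * weightD f₂ g₂
          + weightB f₁ g₁ * weightC f₂ g₂ := by
  obtain ⟨hf₁, hg₁, l₁, s₁⟩ := h₁
  obtain ⟨hf₂, hg₂, l₂, s₂⟩ := h₂
  have dP : (f₁ * f₂).natDegree = f₁.natDegree + f₂.natDegree := natDegree_mul hf₁ hf₂
  have dQ : (Polynomial.X * (g₁ * g₂)).natDegree = g₁.natDegree + g₂.natDegree + 1 := by
    rw [natDegree_X_mul (mul_ne_zero hg₁ hg₂), natDegree_mul hg₁ hg₂]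
  have dg : (f₁ * g₂).natDegree = f₁.natDegree + g₂.natDegree := natDegree_mul hf₁ hg₂
  have cP : (f₁ * f₂).leadingCoeff = f₁.leadingCoeff * f₂.leadingCoeff := leadingCoeff_mul _ _
  have cQ : (Polynomial.X * (g₁ * g₂)).leadingCoeff = g₁.leadingCoeff * g₂.leadingCoeff := by
    rw [leadingCoeff_mul, leadingCoeff_X, one_mul, leadingCoeff_mul]
  have cg : (f₁ * g₂).leadingCoeff = f₁.leadingCoeff * g₂.leadingCoeff := leadingCoeff_mul _ _
  have hP := mul_ne_zero hf₁ hf₂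
  by_cases t₁ : g₁.natDegree < f₁.natDegree <;> by_cases t₂ : g₂.natDegree < f₂.natDegree
  · obtain ⟨d, e⟩ := natDegree_add_of_natDegree_lt
      (show (Polynomial.X * (g₁ * g₂)).natDegree < (f₁ * f₂).natDegree by omega)
    simp [weightA, weightB, weightC, weightD, t₁, t₂, d, e, dP, dg, cP, cg]
  · obtain ⟨d, e⟩ := natDegree_add_of_natDegree_eq hP
      (show (f₁ * f₂).natDegree = (Polynomial.X * (g₁ * g₂)).natDegree by omega)
    simp [weightA, weightB, weightC, weightD, t₁, t₂, d, e, dP, dg, cP, cQ, cg]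
  · obtain ⟨d, e⟩ := natDegree_add_of_natDegree_eq hP
      (show (f₁ * f₂).natDegree = (Polynomial.X * (g₁ * g₂)).natDegree by omega)
    simp [weightA, weightB, weightC, weightD, t₁, t₂, d, e, dP, dg, cP, cQ, cg]
  · obtain ⟨d, e⟩ := natDegree_add_of_natDegree_lt
      (show (f₁ * f₂).natDegree < (Polynomial.X * (g₁ * g₂)).natDegree by omega)
    rw [add_comm] at d e
    have hlt : f₁.natDegree + g₂.natDegree < g₁.natDegree + g₂.natDegree + 1 := by omega
    simp [weightA, weightB, weightC, weightD, t₁, t₂, d, e, dQ, dg, cQ, cg, hlt]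

theorem weightA_add_weightB (f g : ℕ[X]) : weightA f g + weightB f g = f.leadingCoeff := by
  rw [weightA, weightB]
  split_ifs <;> simp

end Weights

theorem egf_coeff_zero (w : ℕ[X] → ℕ[X] → ℚ) :
    PowerSeries.constantCoeff (egf (rootedTotal w)) = 0 := by
  rw [← coeff_zero_eq_constantCoeff_apply, egf, coeff_mk, rootedTotal_zero, zero_div]

theorem egf_coeff_one (w : ℕ[X] → ℕ[X] → ℚ) :
    PowerSeries.coeff 1 (egf (rootedTotal w)) = w 1 1 := by
  rw [egf, coeff_mk, rootedTotal_one, Nat.factorial_one, Nat.cast_one, div_one]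

theorem rootedSystem_egf : RootedSystem (egf (rootedTotal weightA)) (egf (rootedTotal weightB))
    (egf (rootedTotal weightC)) (egf (rootedTotal weightD)) where
  eulerA := by
    rw [euler_egf_rootedTotal weightA ![weightA, weightB, weightC, weightC]
      ![weightA, weightA, weightD, weightC]]
    · simp [Fin.sum_univ_four]
    · intro f₁ g₁ f₂ g₂ h₁ h₂
      simpa [Fin.sum_univ_four] using (weights_join h₁ h₂).1
  eulerB := by
    rw [euler_egf_rootedTotal weightB ![weightA, weightD] ![weightB, weightC]]
    · simp
    · intro f₁ g₁ f₂ g₂ h₁ h₂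
      simpa using (weights_join h₁ h₂).2.1
  eulerC := by
    rw [euler_egf_rootedTotal weightC ![weightA] ![weightC]]
    · simp
    · intro f₁ g₁ f₂ g₂ h₁ h₂
      simpa using (weights_join h₁ h₂).2.2.1
  eulerD := by
    rw [euler_egf_rootedTotal weightD ![weightA, weightB, weightB] ![weightD, weightD, weightC]]
    · simp [Fin.sum_univ_three]
    · intro f₁ g₁ f₂ g₂ h₁ h₂
      simpa [Fin.sum_univ_three] using (weights_join h₁ h₂).2.2.2
  zeroA := egf_coeff_zero _
  zeroB := egf_coeff_zero _
  zeroC := egf_coeff_zero _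
  zeroD := egf_coeff_zero _
  oneA := by rw [egf_coeff_one]; simp [weightA]
  oneB := by rw [egf_coeff_one]; simp [weightB]
  oneC := by rw [egf_coeff_one]; simp [weightC]
  oneD := by rw [egf_coeff_one]; simp [weightD]

/-! ### From rooted to unrooted trees -/

open Classical in
theorem totalMaximumMatchings_eq (n : ℕ) : (totalMaximumMatchings n : ℚ) =
    ∑ T : SimpleGraph (Fin n) with T.IsTree, ((matchingPoly T ∅).leadingCoeff : ℚ) := by
  rw [totalMaximumMatchings, Nat.cast_sum]
  refine Finset.sum_congr (by congr!) fun T _ => ?_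
  rw [numMaximumMatchings_eq]

theorem rootedTotal_weightA_add_weightB (n : ℕ) :
    rootedTotal weightA n + rootedTotal weightB n = n * totalMaximumMatchings n := by
  classical
  rw [rootedTotal_eq, rootedTotal_eq, totalMaximumMatchings_eq, ← Finset.sum_add_distrib,
    Finset.mul_sum]
  refine Finset.sum_congr rfl fun T _ => ?_
  rw [← Finset.sum_add_distrib]
  simp [weightA_add_weightB]

theorem matchingEGF_eq : matchingEGF = egf fun n => (totalMaximumMatchings n : ℚ) := rfl

theorem euler_matchingEGF :
    euler matchingEGF = egf (rootedTotal weightA) + egf (rootedTotal weightB) := by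
  ext n
  rw [matchingEGF_eq, euler_egf, map_add, egf, egf, egf, coeff_mk, coeff_mk, coeff_mk, ← add_div,
    rootedTotal_weightA_add_weightB]

/-- Counts trees with a marked oriented edge: n - 1 edges with two orientations each, which explains
the factor 1/2. The six products are the terms of the joining rules for A and B, whose sum is the
full leading coefficient of f. -/
theorem euler_matchingEGF_sub :
    euler matchingEGF - matchingEGF = (1 / 2 : ℚ) •
      (egf (rootedTotal weightA) * egf (rootedTotal weightA)
        + egf (rootedTotal weightA) * egf (rootedTotal weightB)
        + egf (rootedTotal weightD) * egf (rootedTotal weightC)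
        + egf (rootedTotal weightB) * egf (rootedTotal weightA)
        + egf (rootedTotal weightC) * egf (rootedTotal weightD)
        + egf (rootedTotal weightC) * egf (rootedTotal weightC)) := by
  classical
  ext n
  have hcut := sum_cut (fun _ => 1) (fun f _ => (f.leadingCoeff : ℚ))
    ![weightA, weightA, weightD, weightB, weightC, weightC]
    ![weightA, weightB, weightC, weightA, weightD, weightC]
    (fun f₁ g₁ f₂ g₂ h₁ h₂ => by
      obtain ⟨hA, hB, _⟩ := weights_join h₁ h₂
      rw [← weightA_add_weightB _ (f₁ * g₂), hA, hB]
      simp [Fin.sum_univ_succ]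
      ring) n
  have hdeg : ∑ T : SimpleGraph (Fin n) with T.IsTree, ∑ r, ∑ s with T.Adj s r,
      1 * ((matchingPoly T ∅).leadingCoeff : ℚ) = 2 * (((n : ℚ) - 1) * totalMaximumMatchings n) := by
    rw [totalMaximumMatchings_eq, ← mul_assoc, Finset.mul_sum]
    refine Finset.sum_congr rfl fun T hT => ?_
    simp only [Finset.sum_const, one_mul, nsmul_eq_mul, ← Finset.sum_mul]
    congr 1
    have hE := (Finset.mem_filter.1 hT).2.card_edgeFinset
    have hD := T.sum_degrees_eq_twice_card_edges
    rw [Fintype.card_fin] at hE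
    have hN : ∀ r, (Finset.univ.filter fun s => T.Adj s r).card = T.degree r := by
      intro r
      rw [← SimpleGraph.card_neighborFinset_eq_degree]
      congr 1
      ext s
      simp [SimpleGraph.adj_comm]
    simp only [hN]
    have hE' : (T.edgeFinset.card : ℚ) + 1 = n := by exact_mod_cast hE
    rw [← Nat.cast_sum, hD, ← hE']
    push_cast
    ring
  rw [hdeg] at hcut
  simp only [one_mul] at hcut
  have hn : (n.factorial : ℚ) ≠ 0 := by exact_mod_cast n.factorial_ne_zero
  rw [matchingEGF_eq, euler_egf, map_sub, PowerSeries.coeff_smul]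
  simp only [map_add, coeff_egf_mul, ← add_div]
  rw [egf, egf, coeff_mk, coeff_mk, ← sub_div, smul_eq_mul, ← mul_div_assoc]
  congr 1
  simp [Fin.sum_univ_succ] at hcut
  linarith

theorem coeff_eq_totalMaximumMatchings {n : ℕ} (hn : n ≠ 0) :
    PowerSeries.coeff n (egf (rootedTotal weightA) + egf (rootedTotal weightB))
      * ((n - 1).factorial : ℚ) = totalMaximumMatchings n := by
  obtain ⟨m, rfl⟩ := Nat.exists_eq_succ_of_ne_zero hn
  have h₁ : (m.factorial : ℚ) ≠ 0 := by exact_mod_cast m.factorial_ne_zero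
  have h₂ : ((m : ℚ) + 1) ≠ 0 := by positivity
  rw [map_add, egf, egf, coeff_mk, coeff_mk, ← add_div, rootedTotal_weightA_add_weightB,
    Nat.succ_sub_one, Nat.factorial_succ]
  push_cast
  field_simp

end TreeMatchings

theorem theorem4 :
    (∃! U : PowerSeries ℚ, TreeMatchings.IsSolution U) ∧
    (∀ U : PowerSeries ℚ, TreeMatchings.IsSolution U →
      TreeMatchings.matchingEGF =
        -((1 / 2 : ℚ) • (PowerSeries.X * TreeMatchings.expSeries U + U) ^ 2)
          + (1 + U * (PowerSeries.X * TreeMatchings.expSeries U))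
              * (PowerSeries.X * TreeMatchings.expSeries U)
          + U - U ^ 2) ∧
    List.map TreeMatchings.totalMaximumMatchings [1, 2, 3, 4, 5, 6, 7, 8, 9, 10] =
      [1, 1, 6, 24, 320, 3270, 55482, 999656, 21718440, 544829130] := by
  have hS := TreeMatchings.rootedSystem_egf
  -- Existence is combinatorial: the series A of rooted trees is itself the solution.
  refine ⟨⟨_, hS.isSolution, fun V hV => hV.unique hS.isSolution⟩, fun U hU => ?_, ?_⟩
  · rw [hU.unique hS.isSolution]
    exact hS.unrooted TreeMatchings.euler_matchingEGF TreeMatchings.euler_matchingEGF_sub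
  · have h := hS.coeff_values
    have hmap : List.map (fun n => PowerSeries.coeff n
        (TreeMatchings.egf (TreeMatchings.rootedTotal TreeMatchings.weightA)
          + TreeMatchings.egf (TreeMatchings.rootedTotal TreeMatchings.weightB))
        * ((n - 1).factorial : ℚ)) [1, 2, 3, 4, 5, 6, 7, 8, 9, 10]
        = List.map (fun n => (TreeMatchings.totalMaximumMatchings n : ℚ))
          [1, 2, 3, 4, 5, 6, 7, 8, 9, 10] := by
      refine List.map_congr_left fun n hn => ?_
      refine TreeMatchings.coeff_eq_totalMaximumMatchings ?_
      rintro rfl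
      simp at hn
    rw [hmap] at h
    simp only [List.map_cons, List.map_nil, List.cons.injEq, and_true] at h ⊢
    exact_mod_cast h
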